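/- **Setting.** Let $\mathcal V=\mathcal V_g\cup\mathcal V_l$ be the $n=n_g+n_l$ buses (generators, loads) of a connected undirected graph with neighbour sets $\mathcal N_i$ and edge set $\mathcal E$, with line parameters $B_{ij}=B_{ji}\in\mathbb R$, shunts $\hat B_{ii}\ge 0$, $B_{ii}=\sum_{j\in\mathcal N_i}B_{ij}+\hat B_{ii}$, damping $A_i>0$ ($i\in\mathcal V$), and $M_i>0$, $T_i>0$, $X_{di}>X_{di}'$, $E_{fi}\in\mathbb R$ ($i\in\mathcal V_g$), and constant reactive demands $\bar Q_{li}\ge 0$ ($i\in\mathcal V_l$). Let $\hat D\in\mathbb R^{n\times(n-1)}$ have full column rank and $\ker\hat D^T=\mathrm{span}\{\mathbb 1_n\}$; put $\varphi=\hat D^T\delta$, so that the angle differences $\delta_{ij}=\delta_i-\delta_j$ are functions of $\varphi$. Let $C:\mathbb R^{n_g}\to\mathbb R$ be strictly convex, $U:\mathbb R^{n_l}\to\mathbb R$ strictly concave, both twice continuously differentiable, $D_c\in\mathbb R^{n\times m_c}$, and let $\tau_g,\tau_l,\tau_v,\tau_{\lambda_g},\tau_{\lambda_l}$ be symmetric positive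 definite matrices, $\tau_c$ their block-diagonal sum. Subscripts $g,l$ on $\hat D,D_c$ denote the generator and load rows, $A_g=\mathrm{diag}(A_i)_{i\in\mathcal V_g}$, $A_l=\mathrm{diag}(A_i)_{i\in\mathcal V_l}$, $R_g=\mathrm{diag}((X_{di}-X_{di}')/T_i)$, and $[E_l]=\mathrm{diag}(E_i)_{i\in\mathcal V_l}$. The state is $x=\mathrm{col}(x_c,x_p)$ with $x_p=\mathrm{col}(\varphi,p_g,E_g,E_l)$, all $E_i>0$, and $x_c=\tau_c z_c$, $z_c=\mathrm{col}(P_g,P_l,v,\lambda_g,\lambda_l)$. Put $\omega_i=M_i^{-1}p_i$ for $i\in\mathcal V_g$, $S(z_c)=U(P_l)-C(P_g)$, $H_c=\frac12x_c^T\tau_c^{-1}x_c$, and $$H_p=\tfrac12\sum_{i\in\mathcal V_g}\Big(M_i^{-1}p_i^2+\tfrac{(E_i-E_{fi})^2}{X_{di}-X_{di}'}\Big)+\tfrac12\sum_{i\in\mathcal V}B_{ii}E_i^2-\sum_{(i,j)\in\mathcal E}B_{ij}E_iE_j\cos\delta_{ij}.$$ The closed-loop system of power network and dynamic pricing algorithm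 is $$\begin{aligned} \tau_g\dot P_g&=-\nabla C(P_g)+\lambda_g-\omega_g, & \tau_l\dot P_l&=\nabla U(P_l)-\lambda_l+\omega_l, & \tau_v\dot v&=-D_{cg}^T\lambda_g-D_{cl}^T\lambda_l,\\ \tau_{\lambda_g}\dot\lambda_g&=D_{cg}v-P_g, & \tau_{\lambda_l}\dot\lambda_l&=D_{cl}v+P_l, & \dot\varphi&=\hat D_g^T\omega_g+\hat D_l^T\omega_l,\\ \dot p_g&=-\hat D_g\nabla_\varphi H_p-A_g\omega_g+P_g, & \dot E_g&=-R_g\nabla_{E_g}H_p, & &\\ 0&=-[E_l]\nabla_{E_l}H_p+\bar Q_l, & 0&=-\hat D_l\nabla_\varphi H_p-A_l\omega_l-P_l. & & \end{aligned}\tag{1}$$ Given an equilibrium $(\bar x,\bar\omega_l)$ of (1), put $\bar H_p(x)=H_p(x)-(x-\bar x)^T\nabla H_p(\bar x)-H_p(\bar x)$, likewise $\bar H_c$, $\bar H_a(x)=E_l^T\nabla_{E_l}H_p(\bar x)-\bar Q_l^T\log E_l$ (elementwise logarithm), and $\bar H=\bar H_p+\bar H_a+\bar H_c$. After elimination of $\omega_l$,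 (1) takes the shifted port-Hamiltonian form $$\begin{bmatrix}\dot x_c\\\dot\varphi\\\dot p_g\\\dot E_g\\0\end{bmatrix}= \begin{bmatrix}J_c-G_2A_l^{-1}G_2^T&-G_2A_l^{-1}\hat D_l&-G_1&0&0\\-\hat D_l^TA_l^{-1}G_2^T&-\hat D_l^TA_l^{-1}\hat D_l&\hat D_g^T&0&0\\G_1^T&-\hat D_g&-A_g&0&0\\0&0&0&-R_g&0\\0&0&0&0&-[E_l]\end{bmatrix}\nabla\bar H(x)+\begin{bmatrix}\nabla S(\tau_c^{-1}x_c)-\nabla S(\tau_c^{-1}\bar x_c)\\0\\0\\0\\0\end{bmatrix},\tag{2}$$ where $G_1^T=[I\ 0\ 0\ 0\ 0]$, $G_2^T=[0\ I\ 0\ 0\ 0]$ select the $P_g$- and $P_l$-blocks and $$J_c=\begin{bmatrix}0&0&0&I&0\\0&0&0&0&-I\\0&0&0&-D_{cg}^T&-D_{cl}^T\\-I&0&D_{cg}&0&0\\0&I&D_{cl}&0&0\end{bmatrix}.$$ **Theorem 2.** Suppose that $m_c=n-1$ and $D_c$ is the incidence matrix of a tree on $\mathcal V$, and that the closed-loop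 system has an equilibrium $(\bar x,\bar\omega_l)$ with $\nabla^2\bar H(\bar x)>0$. Then $\bar x$ is a locally asymptotically stable equilibrium of (2): from every consistent initial state near $\bar x$ there is a unique solution of (2), it exists for all $t\ge0$, and $\bar x$ is Lyapunov stable and locally attractive for these solutions. Moreover the frequency deviations vanish at the equilibrium, $\bar\omega_g=0$ and $\bar\omega_l=0$, and $(\bar P_g,\bar P_l,\bar v,\bar\lambda_g,\bar\lambda_l)=\tau_c^{-1}\bar x_c$ satisfies the KKT conditions of the problem of maximizing $U(P_l)-C(P_g)$ subject to $-D_cv+\mathrm{col}(P_g,-P_l)=0$: $$\nabla C(\bar P_g)=\bar\lambda_g,\quad \nabla U(\bar P_l)=\bar\lambda_l,\quad D_{cg}^T\bar\lambda_g+D_{cl}^T\bar\lambda_l=0,\quad D_{cg}\bar v=\bar P_g,\quad D_{cl}\bar v=-\bar P_l.$$ -/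

import Mathlib

open Matrix Set Filter Topology

noncomputable section

/-! ### Gradients, Hessians, shifted functions -/

/-- The gradient `∇F(x)`, as the column of partial derivatives. -/
def grad {ι : Type} [Fintype ι] [DecidableEq ι] (F : (ι → ℝ) → ℝ) (x : ι → ℝ) : ι → ℝ :=
  fun i => fderiv ℝ F x (Pi.single i 1)

/-- The Hessian `∇²F(x)`, as the matrix of second partial derivatives. -/
def hess {ι : Type} [Fintype ι] [DecidableEq ι] (F : (ι → ℝ) → ℝ) (x : ι → ℝ) :
    Matrix ι ι ℝ :=
  Matrix.of fun i j => fderiv ℝ (fun y => grad F y j) x (Pi.single i 1)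

/-- The shifted function `F(x) - (x - x̄)ᵀ ∇F(x̄) - F(x̄)`. -/
def shifted {ι : Type} [Fintype ι] [DecidableEq ι] (F : (ι → ℝ) → ℝ) (xbar x : ι → ℝ) : ℝ :=
  F x - (x - xbar) ⬝ᵥ grad F xbar - F xbar

/-! ### Differential-algebraic equations -/

/-- A semi-explicit differential-algebraic system `ẋ = f(x, y)`, `0 = g(x, y)` on a set `dom` of
admissible states; `ι` indexes the differential variables `x`, `κ` the algebraic variables `y`. -/
structure DAE (ι κ : Type) where
  dom : Set (ι ⊕ κ → ℝ)
  f : (ι ⊕ κ → ℝ) → ι → ℝ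
  g : (ι ⊕ κ → ℝ) → κ → ℝ

namespace DAE

variable {ι κ : Type}

/-- Equilibria: admissible states where both right-hand sides vanish. -/
def IsEquilibrium (S : DAE ι κ) (x : ι ⊕ κ → ℝ) : Prop :=
  x ∈ S.dom ∧ S.f x = 0 ∧ S.g x = 0

/-- Consistent initial states. -/
def consistent (S : DAE ι κ) : Set (ι ⊕ κ → ℝ) := {x | x ∈ S.dom ∧ S.g x = 0}

/-- `x` is a (classical) solution on `J`: a continuous curve of admissible states whose
differential variables satisfy the differential equation and which satisfies the algebraic
equation. -/
structure IsSolutionOn (S : DAE ι κ) (J : Set ℝ) (x : ℝ → ι ⊕ κ → ℝ) : Prop where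
  continuousOn : ContinuousOn x J
  mem_dom : ∀ t ∈ J, x t ∈ S.dom
  differential : ∀ t ∈ J, ∀ i, HasDerivWithinAt (fun s => x s (Sum.inl i)) (S.f (x t) i) J t
  algebraic : ∀ t ∈ J, S.g (x t) = 0

/-- Local asymptotic stability of an equilibrium of a differential-algebraic system: from every
consistent initial state near the equilibrium there is a solution for all `t ≥ 0`, unique on every
interval of existence; and the equilibrium is Lyapunov stable and locally attractive. -/
structure LocallyAsymptoticallyStable [Fintype ι] [Fintype κ] (S : DAE ι κ)
    (xbar : ι ⊕ κ → ℝ) : Prop where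
  equilibrium : S.IsEquilibrium xbar
  wellPosed : ∃ r > 0, ∀ x₀ ∈ S.consistent, dist x₀ xbar < r →
    ∃ x : ℝ → ι ⊕ κ → ℝ, S.IsSolutionOn (Ici 0) x ∧ x 0 = x₀ ∧
      ∀ (J : Set ℝ) (y : ℝ → ι ⊕ κ → ℝ), J ⊆ Ici 0 → J.OrdConnected → (0 : ℝ) ∈ J →
        S.IsSolutionOn J y → y 0 = x₀ → EqOn y x J
  stable : ∀ ε > 0, ∃ δ > 0, ∀ x : ℝ → ι ⊕ κ → ℝ, S.IsSolutionOn (Ici 0) x →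
    dist (x 0) xbar < δ → ∀ t ≥ 0, dist (x t) xbar < ε
  attractive : ∃ δ > 0, ∀ x : ℝ → ι ⊕ κ → ℝ, S.IsSolutionOn (Ici 0) x →
    dist (x 0) xbar < δ → Tendsto x atTop (𝓝 xbar)

end DAE

/-! ### Incidence matrix of a tree -/

/-- `D` is the incidence matrix of a tree with node set `V` whose edges are enumerated by `K` and
arbitrarily oriented: column `k` has `+1` at the head of edge `k`, `-1` at its tail, `0` elsewhere. -/
def IsTreeIncidence {V K : Type} [DecidableEq V] (D : Matrix V K ℝ) : Prop :=
  ∃ (T : SimpleGraph V) (tail head : K → V), T.IsTree ∧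
    BijOn (fun k => s(tail k, head k)) univ T.edgeSet ∧
    ∀ i k, D i k = (if i = head k then 1 else 0) - (if i = tail k then 1 else 0)

/-! ### Index sets -/

/-- Buses: generator nodes, then load nodes. -/
abbrev Bus (ng nl : ℕ) : Type := Fin ng ⊕ Fin nl

/-- Index set of the controller state `x_c = col(x_g, x_l, x_v, x_λg, x_λl)`. -/
abbrev CIdx (ng nl mc : ℕ) : Type := Fin ng ⊕ (Fin nl ⊕ (Fin mc ⊕ (Fin ng ⊕ Fin nl)))

/-- Index set of the differential variables `col(x_c, φ, p_g, E_g)`. -/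
abbrev DIdx (ng nl mc : ℕ) : Type :=
  CIdx ng nl mc ⊕ (Fin (ng + nl - 1) ⊕ (Fin ng ⊕ Fin ng))

/-- Index set of the full state `x = col(x_c, φ, p_g, E_g, E_l)`. -/
abbrev XIdx (ng nl mc : ℕ) : Type := DIdx ng nl mc ⊕ Fin nl

/-- States `x = col(x_c, φ, p_g, E_g, E_l)`. -/
abbrev State (ng nl mc : ℕ) : Type := XIdx ng nl mc → ℝ

section Blocks

variable {ng nl mc : ℕ}

/-! Blocks of a vector indexed like `x_c`. -/

def cG (w : CIdx ng nl mc → ℝ) : Fin ng → ℝ := fun i => w (.inl i)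
def cL (w : CIdx ng nl mc → ℝ) : Fin nl → ℝ := fun i => w (.inr (.inl i))
def cV (w : CIdx ng nl mc → ℝ) : Fin mc → ℝ := fun k => w (.inr (.inr (.inl k)))
def cLamG (w : CIdx ng nl mc → ℝ) : Fin ng → ℝ := fun i => w (.inr (.inr (.inr (.inl i))))
def cLamL (w : CIdx ng nl mc → ℝ) : Fin nl → ℝ := fun i => w (.inr (.inr (.inr (.inr i))))

/-! Blocks of a vector indexed like `x` (a state or a gradient). -/

def xC (w : State ng nl mc) : CIdx ng nl mc → ℝ := fun i => w (.inl (.inl i))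
def xPhi (w : State ng nl mc) : Fin (ng + nl - 1) → ℝ := fun k => w (.inl (.inr (.inl k)))
def xP (w : State ng nl mc) : Fin ng → ℝ := fun i => w (.inl (.inr (.inr (.inl i))))
def xEg (w : State ng nl mc) : Fin ng → ℝ := fun i => w (.inl (.inr (.inr (.inr i))))
def xEl (w : State ng nl mc) : Fin nl → ℝ := fun i => w (.inr i)

/-- The voltages `E_i` at all buses. -/
def xE (w : State ng nl mc) : Bus ng nl → ℝ := Sum.elim (xEg w) (xEl w)

/-- `col(a, b, c, d, e)` as a vector indexed like `x_c`. -/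
def colC (a : Fin ng → ℝ) (b : Fin nl → ℝ) (c : Fin mc → ℝ) (d : Fin ng → ℝ) (e : Fin nl → ℝ) :
    CIdx ng nl mc → ℝ :=
  Sum.elim a (Sum.elim b (Sum.elim c (Sum.elim d e)))

/-- `col(c, φ, p, E_g)` as a vector indexed like the differential variables. -/
def colD (c : CIdx ng nl mc → ℝ) (φ : Fin (ng + nl - 1) → ℝ) (p Eg : Fin ng → ℝ) :
    DIdx ng nl mc → ℝ :=
  Sum.elim c (Sum.elim φ (Sum.elim p Eg))

end Blocks

/-! ### The model -/

/-- Data of a power network with `ng` generators and `nl` loads and of a dynamic pricing algorithm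
on a communication graph with `mc` edges. -/
structure Model (ng nl mc : ℕ) where
  /-- transmission network -/
  graph : SimpleGraph (Bus ng nl)
  /-- negatives of the line susceptances `B_ij` (only the values on lines are used) -/
  B : Bus ng nl → Bus ng nl → ℝ
  /-- negatives of the shunt susceptances -/
  Bhat : Bus ng nl → ℝ
  /-- damping constants -/
  A : Bus ng nl → ℝ
  /-- moments of inertia -/
  M : Fin ng → ℝ
  /-- open-circuit transient time constants -/
  T : Fin ng → ℝ
  /-- synchronous reactances -/
  Xd : Fin ng → ℝ
  /-- transient reactances -/
  Xd' : Fin ng → ℝ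
  /-- excitation voltages -/
  Ef : Fin ng → ℝ
  /-- reactive power demands -/
  Q : Fin nl → ℝ
  /-- matrix of the change of angle coordinates `φ = D̂ᵀ δ` -/
  Dhat : Matrix (Bus ng nl) (Fin (ng + nl - 1)) ℝ
  /-- incidence matrix of the communication graph -/
  Dc : Matrix (Bus ng nl) (Fin mc) ℝ
  /-- generation cost -/
  C : (Fin ng → ℝ) → ℝ
  /-- consumption utility -/
  U : (Fin nl → ℝ) → ℝ
  τg : Matrix (Fin ng) (Fin ng) ℝ
  τl : Matrix (Fin nl) (Fin nl) ℝ
  τv : Matrix (Fin mc) (Fin mc) ℝ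
  τlamg : Matrix (Fin ng) (Fin ng) ℝ
  τlaml : Matrix (Fin nl) (Fin nl) ℝ

namespace Model

variable {ng nl mc : ℕ} (S : Model ng nl mc)

/-- Standing assumptions on the data. -/
structure Standing : Prop where
  connected : S.graph.Connected
  B_symm : ∀ i j, S.B i j = S.B j i
  Bhat_nonneg : ∀ i, 0 ≤ S.Bhat i
  A_pos : ∀ i, 0 < S.A i
  M_pos : ∀ i, 0 < S.M i
  T_pos : ∀ i, 0 < S.T i
  Xd_gt : ∀ i, S.Xd' i < S.Xd i
  Q_nonneg : ∀ i, 0 ≤ S.Q i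
  Dhat_rank : S.Dhat.rank = ng + nl - 1
  Dhat_ker : LinearMap.ker (S.Dhatᵀ).mulVecLin = Submodule.span ℝ {fun _ => (1 : ℝ)}
  C_smooth : ContDiff ℝ 2 S.C
  U_smooth : ContDiff ℝ 2 S.U
  C_convex : StrictConvexOn ℝ univ S.C
  U_concave : StrictConcaveOn ℝ univ S.U
  τg_pos : S.τg.PosDef
  τl_pos : S.τl.PosDef
  τv_pos : S.τv.PosDef
  τlamg_pos : S.τlamg.PosDef
  τlaml_pos : S.τlaml.PosDef

/-- `B_ii = ∑_{j ∈ N_i} B_ij + B̂_ii`. -/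
def Bself (i : Bus ng nl) : ℝ :=
  open Classical in (∑ j with S.graph.Adj i j, S.B i j) + S.Bhat i

/-- An angle vector `δ` with `D̂ᵀ δ = φ`. It is unique up to a common rotation of all angles, on
which the differences `δ_i - δ_j` do not depend. -/
def angle (φ : Fin (ng + nl - 1) → ℝ) : Bus ng nl → ℝ :=
  S.Dhat *ᵥ ((S.Dhatᵀ * S.Dhat)⁻¹ *ᵥ φ)

/-- Energy `H_p` of the generators and the transmission network. Every (undirected) line occurs
twice in the double sum over neighbours, hence the factor `1/2` in front of it. -/
def Hp (x : State ng nl mc) : ℝ :=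
  open Classical in
  1 / 2 * ∑ i, ((S.M i)⁻¹ * xP x i ^ 2 + (xEg x i - S.Ef i) ^ 2 / (S.Xd i - S.Xd' i))
  + 1 / 2 * ∑ i, S.Bself i * xE x i ^ 2
  - 1 / 2 * ∑ i, ∑ j with S.graph.Adj i j, S.B i j * xE x i * xE x j *
      Real.cos (S.angle (xPhi x) i - S.angle (xPhi x) j)

/-- The block-diagonal matrix `τ_c`. -/
def τc : Matrix (CIdx ng nl mc) (CIdx ng nl mc) ℝ :=
  fromBlocks S.τg 0 0 (fromBlocks S.τl 0 0 (fromBlocks S.τv 0 0 (fromBlocks S.τlamg 0 0 S.τlaml)))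

/-- `z_c = τ_c⁻¹ x_c = col(P_g, P_l, v, λ_g, λ_l)`. -/
def zc (x : State ng nl mc) : CIdx ng nl mc → ℝ := (S.τc)⁻¹ *ᵥ xC x

/-- Controller Hamiltonian `H_c = ½ x_cᵀ τ_c⁻¹ x_c`. -/
def Hc (x : State ng nl mc) : ℝ := 1 / 2 * (xC x ⬝ᵥ ((S.τc)⁻¹ *ᵥ xC x))

/-- Social welfare `U(P_l) - C(P_g)`, as a function of `z_c`. -/
def welfare (z : CIdx ng nl mc → ℝ) : ℝ := S.U (cL z) - S.C (cG z)

/-- The product `J_c w`, where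
`J_c = [0 0 0 I 0; 0 0 0 0 -I; 0 0 0 -D_cgᵀ -D_clᵀ; -I 0 D_cg 0 0; 0 I D_cl 0 0]`. -/
def Jc (w : CIdx ng nl mc → ℝ) : CIdx ng nl mc → ℝ :=
  colC (cLamG w) (-cLamL w)
    (-(S.Dc.toRows₁ᵀ *ᵥ cLamG w) - S.Dc.toRows₂ᵀ *ᵥ cLamL w)
    (-cG w + S.Dc.toRows₁ *ᵥ cV w)
    (cL w + S.Dc.toRows₂ *ᵥ cV w)

def Ag : Matrix (Fin ng) (Fin ng) ℝ := diagonal fun i => S.A (.inl i)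

def Al : Matrix (Fin nl) (Fin nl) ℝ := diagonal fun i => S.A (.inr i)

def Rg : Matrix (Fin ng) (Fin ng) ℝ := diagonal fun i => (S.Xd i - S.Xd' i) / S.T i

/-- Frequency deviations `ω_g = M⁻¹ p_g` at the generators. -/
def omegaG (x : State ng nl mc) : Fin ng → ℝ := fun i => (S.M i)⁻¹ * xP x i

/-! ### The closed-loop system -/

/-- State `(x, ω_l)` of the closed-loop system before elimination of the load frequencies. -/
def join (x : State ng nl mc) (ωl : Fin nl → ℝ) : DIdx ng nl mc ⊕ (Fin nl ⊕ Fin nl) → ℝ :=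
  Sum.elim (fun i => x (.inl i)) (Sum.elim (xEl x) ωl)

/-- The `x`-part of `(x, ω_l)`. -/
def statePart (y : DIdx ng nl mc ⊕ (Fin nl ⊕ Fin nl) → ℝ) : State ng nl mc :=
  Sum.elim (fun i => y (.inl i)) (fun i => y (.inr (.inl i)))

/-- The `ω_l`-part of `(x, ω_l)`. -/
def freqPart (y : DIdx ng nl mc ⊕ (Fin nl ⊕ Fin nl) → ℝ) : Fin nl → ℝ :=
  fun i => y (.inr (.inr i))

/-- The interconnection of the power network with the pricing algorithm, as a
differential-algebraic system with algebraic variables `E_l` and `ω_l`, on the set of states with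
positive voltages. Here `h = ∇(H_p + H_c)`, and `ω_l` is the gradient of `U_p(ω_l) = ½ ω_lᵀ ω_l`. -/
def closedLoop : DAE (DIdx ng nl mc) (Fin nl ⊕ Fin nl) where
  dom := {y | ∀ i, 0 < xE (statePart y) i}
  f := fun y =>
    let x := statePart y
    let ωl := freqPart y
    let h := grad (fun x => S.Hp x + S.Hc x) x
    colD
      (S.Jc (xC h) + colC (-xP h) ωl 0 0 0 + grad S.welfare (S.zc x))
      (S.Dhat.toRows₁ᵀ *ᵥ xP h + S.Dhat.toRows₂ᵀ *ᵥ ωl)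
      (cG (xC h) - S.Dhat.toRows₁ *ᵥ xPhi h - S.Ag *ᵥ xP h)
      (-(S.Rg *ᵥ xEg h))
  g := fun y =>
    let x := statePart y
    let ωl := freqPart y
    let h := grad (fun x => S.Hp x + S.Hc x) x
    Sum.elim
      (-(diagonal (xEl x) *ᵥ xEl h) + S.Q)
      (-cL (xC h) - S.Dhat.toRows₂ *ᵥ xPhi h - S.Al *ᵥ ωl)

/-- `H̄_a(x) = E_lᵀ ∇_{E_l} H_p(x̄) - Q̄_lᵀ log E_l`. -/
def Habar (xbar x : State ng nl mc) : ℝ :=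
  xEl x ⬝ᵥ xEl (grad S.Hp xbar) - S.Q ⬝ᵥ fun i => Real.log (xEl x i)

/-- Shifted Hamiltonian `H̄ = H̄_p + H̄_a + H̄_c`. -/
def Hbar (xbar x : State ng nl mc) : ℝ :=
  shifted S.Hp xbar x + S.Habar xbar x + shifted S.Hc xbar x

/-- The closed-loop system in shifted port-Hamiltonian form after elimination of `ω_l`, on the set
of states with positive voltages. Here `h = ∇H̄(x)`. -/
def shiftedSystem (xbar : State ng nl mc) : DAE (DIdx ng nl mc) (Fin nl) where
  dom := {x | ∀ i, 0 < xE x i}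
  f := fun x =>
    let h := grad (S.Hbar xbar) x
    colD
      (S.Jc (xC h)
        + colC (-xP h)
            (-((S.Al)⁻¹ *ᵥ cL (xC h)) - (S.Al)⁻¹ *ᵥ (S.Dhat.toRows₂ *ᵥ xPhi h)) 0 0 0
        + (grad S.welfare (S.zc x) - grad S.welfare (S.zc xbar)))
      (-(S.Dhat.toRows₂ᵀ *ᵥ ((S.Al)⁻¹ *ᵥ cL (xC h)))
        - S.Dhat.toRows₂ᵀ *ᵥ ((S.Al)⁻¹ *ᵥ (S.Dhat.toRows₂ *ᵥ xPhi h))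
        + S.Dhat.toRows₁ᵀ *ᵥ xP h)
      (cG (xC h) - S.Dhat.toRows₁ *ᵥ xPhi h - S.Ag *ᵥ xP h)
      (-(S.Rg *ᵥ xEg h))
  g := fun x => -(diagonal (xEl x) *ᵥ xEl (grad (S.Hbar xbar) x))

/-- Karush-Kuhn-Tucker conditions of the social welfare problem: maximize `U(P_l) - C(P_g)` over
`(P_g, P_l, v)` subject to `-D_c v + col(P_g, -P_l) = 0`, with multipliers `(λ_g, λ_l)`. -/
structure KKT (Pg : Fin ng → ℝ) (Pl : Fin nl → ℝ) (v : Fin mc → ℝ)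
    (lamg : Fin ng → ℝ) (laml : Fin nl → ℝ) : Prop where
  cost : grad S.C Pg - lamg = 0
  utility : -grad S.U Pl + laml = 0
  price : S.Dc.toRows₁ᵀ *ᵥ lamg + S.Dc.toRows₂ᵀ *ᵥ laml = 0
  balance_g : -(S.Dc.toRows₁ *ᵥ v) + Pg = 0
  balance_l : -(S.Dc.toRows₂ *ᵥ v) - Pl = 0

end Model

end

/-! The shifted energy H̄ is a Lyapunov function. Along solutions of the shifted system the
skew-symmetric part of the structure matrix contributes nothing to dH̄/dt. What remains is
nonpositive: damping at generators and at loads (after elimination of ω_l), the voltage term with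
R_g, and the welfare term, whose sign is the monotonicity of ∇C and -∇U (`dissipation`).

Positive definiteness of the Hessian makes ∇H̄ strongly monotone on a ball around the equilibrium,
and this one inequality replaces index theory for the differential-algebraic system. Since voltages
are positive, the algebraic equation says ∇_{E_l} H̄ = 0. Strong monotonicity then makes E_l a
Lipschitz function of the differential variables (`exists_dist_le`), minimizing H̄ over E_l shows
that it exists (`exists_algebraic_solution`), and H̄ grows quadratically away from the equilibrium
(`quadratic_le`). Locally the system is thus a Lipschitz ordinary differential equation whose
solutions are trapped by sublevel sets of H̄. This yields well-posedness and Lyapunov stability;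
LaSalle's principle yields attractivity (`exists_forall_tendsto`).

LaSalle's principle needs every solution conserving H̄ to start at a critical point
(`grad_Hbar_eq_zero_of_conserved`). Zero dissipation fixes P_g and P_l by strict convexity and
concavity, as well as ω_g and ∇_{E_g} H̄. Constant P_g, P_l force λ_g, λ_l to their equilibrium
values; constant λ then gives D_c(v - v̄) = 0, and constant p_g gives D̂ ∇_φ H̄ = 0. Both matrices
have n - 1 columns and left kernel within the constants, so they are injective; for D_c this is
where the tree enters.

At an equilibrium D̂ᵀω = 0 gives a common frequency a. Summing the power balance over all buses
cancels the flows and the communicated exchange, leaving (∑ A_i) a = 0. With ω = 0 the controller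
equations are the KKT conditions (`omega_eq_zero_and_kkt`). -/

noncomputable section

/-! ### Global solutions of ordinary differential equations -/

/-- A bounded, globally Lipschitz vector field has global solutions. -/
theorem exists_forall_hasDerivAt_of_lipschitzWith {E : Type*} [NormedAddCommGroup E]
    [NormedSpace ℝ E] [CompleteSpace E] {F : E → E} {K L : NNReal} (hF : LipschitzWith K F)
    (hL : ∀ x, ‖F x‖ ≤ L) (x₀ : E) :
    ∃ y : ℝ → E, y 0 = x₀ ∧ ∀ t, HasDerivAt y (F (y t)) t := by
  have key : ∀ n : ℕ, ∃ y : ℝ → E, y 0 = x₀ ∧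
      ∀ t ∈ Ioo (-((n : ℝ) + 1)) ((n : ℝ) + 1), HasDerivAt y (F (y t)) t := by
    intro n
    have h0 : (0 : ℝ) ∈ Icc (-((n : ℝ) + 1)) ((n : ℝ) + 1) := by
      constructor <;> have := n.cast_nonneg (α := ℝ) <;> linarith
    -- A curve of speed at most L travels at most L(n + 1) in time n + 1, so a ball of that radius
    -- never restricts the time interval.
    have hPL : IsPicardLindelof (fun _ => F) (⟨0, h0⟩ : Icc (-((n : ℝ) + 1)) ((n : ℝ) + 1)) x₀
        (L * (n + 1)) 0 L K :=
      IsPicardLindelof.of_time_independent (fun x _ => hL x) hF.lipschitzOnWith (by simp)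
    obtain ⟨y, hy0, hy⟩ := hPL.exists_eq_forall_mem_Icc_hasDerivWithinAt₀
    exact ⟨y, hy0, fun t ht => (hy t (Ioo_subset_Icc_self ht)).hasDerivAt
      (Icc_mem_nhds ht.1 ht.2)⟩
  choose Y hY0 hY using key
  have agree : ∀ m n : ℕ, m ≤ n →
      EqOn (Y m) (Y n) (Ioo (-((m : ℝ) + 1)) ((m : ℝ) + 1)) := by
    intro m n hmn
    have hmn' : (m : ℝ) ≤ n := by exact_mod_cast hmn
    have hm := m.cast_nonneg (α := ℝ)
    refine ODE_solution_unique_of_mem_Ioo (v := fun _ => F) (s := fun _ => univ) (K := K) (t₀ := 0)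
      (fun _ _ => hF.lipschitzOnWith) ⟨by linarith, by linarith⟩
      (fun t ht => ⟨hY m t ht, trivial⟩)
      (fun t ht => ⟨hY n t ⟨by linarith [ht.1], by linarith [ht.2]⟩, trivial⟩) ?_
    rw [hY0, hY0]
  -- The local solutions are glued; the extra 1 in the interval lengths puts t in the interior of
  -- the domain of the solution chosen at t.
  refine ⟨fun t => Y ⌈|t|⌉₊ t, hY0 _, fun t => ?_⟩
  have hceil : ∀ s : ℝ, s ∈ Ioo (-((⌈|s|⌉₊ : ℝ) + 1)) ((⌈|s|⌉₊ : ℝ) + 1) := fun s =>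
    abs_lt.1 ((Nat.le_ceil |s|).trans_lt (by linarith))
  refine (hY ⌈|t|⌉₊ t (hceil t)).congr_of_eventuallyEq ?_
  filter_upwards [Ioo_mem_nhds (hceil t).1 (hceil t).2] with s hs
  rcases le_total ⌈|s|⌉₊ ⌈|t|⌉₊ with h | h
  · exact agree _ _ h (hceil s)
  · exact (agree _ _ h hs).symm

/-! ### Gradients and Hessians -/

section Grad

variable {ι : Type} [Fintype ι]

theorem abs_dotProduct_le (v w : ι → ℝ) : |v ⬝ᵥ w| ≤ Fintype.card ι * ‖v‖ * ‖w‖ := by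
  calc |v ⬝ᵥ w| ≤ ∑ i, |v i * w i| := Finset.abs_sum_le_sum_abs _ _
    _ ≤ ∑ _i : ι, ‖v‖ * ‖w‖ := by
        refine Finset.sum_le_sum fun i _ => ?_
        rw [abs_mul]
        exact mul_le_mul (norm_le_pi_norm v i) (norm_le_pi_norm w i) (abs_nonneg _) (norm_nonneg _)
    _ = Fintype.card ι * ‖v‖ * ‖w‖ := by simp [mul_assoc]

/-- By homogeneity it suffices to take the minimum over the unit sphere, which is compact. The norm
is the sup norm, so the constant need not be the least eigenvalue. -/
theorem Matrix.PosDef.exists_mul_norm_sq_le {A : Matrix ι ι ℝ} (hA : A.PosDef) :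
    ∃ c > 0, ∀ v, c * ‖v‖ ^ 2 ≤ v ⬝ᵥ (A *ᵥ v) := by
  rcases isEmpty_or_nonempty ι with hι | hι
  · exact ⟨1, one_pos, fun v => by simp [Subsingleton.elim v 0]⟩
  have hcont : Continuous fun v : ι → ℝ => v ⬝ᵥ (A *ᵥ v) := by fun_prop
  obtain ⟨u, hu, hmin⟩ := (isCompact_sphere (0 : ι → ℝ) 1).exists_isMinOn
    (NormedSpace.sphere_nonempty.2 zero_le_one) hcont.continuousOn
  have hu1 : ‖u‖ = 1 := by simpa using hu
  have hu0 : u ≠ 0 := by rintro rfl; simp at hu1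
  have hpos : ∀ v : ι → ℝ, v ≠ 0 → 0 < v ⬝ᵥ (A *ᵥ v) := fun v hv => by
    simpa using hA.dotProduct_mulVec_pos hv
  refine ⟨_, hpos u hu0, fun v => ?_⟩
  rcases eq_or_ne v 0 with rfl | hv
  · simp
  have hn : 0 < ‖v‖ := norm_pos_iff.2 hv
  have h1 : (‖v‖⁻¹ • v) ∈ Metric.sphere (0 : ι → ℝ) 1 := by
    simp [norm_smul, hn.ne']
  have h2 := hmin h1
  simp only [mem_ofPred_eq, smul_dotProduct, mulVec_smul, dotProduct_smul, smul_eq_mul] at h2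
  calc _ ≤ (‖v‖⁻¹ * (‖v‖⁻¹ * (v ⬝ᵥ (A *ᵥ v)))) * ‖v‖ ^ 2 := by gcongr
    _ = _ := by field_simp

variable [DecidableEq ι] {F : (ι → ℝ) → ℝ} {x : ι → ℝ}

theorem ContinuousLinearMap.apply_eq_sum_single {M : Type*} [AddCommGroup M] [Module ℝ M]
    [TopologicalSpace M] (L : (ι → ℝ) →L[ℝ] M) (v : ι → ℝ) :
    L v = ∑ i, v i • L (Pi.single i 1) := by
  conv_lhs => rw [pi_eq_sum_univ' v]
  simp only [map_sum, map_smul]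

theorem fderiv_eq_grad_dotProduct (F : (ι → ℝ) → ℝ) (x v : ι → ℝ) :
    fderiv ℝ F x v = grad F x ⬝ᵥ v := by
  rw [ContinuousLinearMap.apply_eq_sum_single]
  simp [dotProduct, grad, mul_comm]

theorem HasFDerivAt.grad_eq {F' : (ι → ℝ) →L[ℝ] ℝ} (h : HasFDerivAt F F' x) :
    grad F x = fun i => F' (Pi.single i 1) := by
  ext i
  rw [grad, h.fderiv]

theorem ContDiffAt.grad_of_two (h : ContDiffAt ℝ 2 F x) : ContDiffAt ℝ 1 (grad F) x := by
  have h' : ContDiffAt ℝ 1 (fderiv ℝ F) x := h.fderiv_right (by norm_num)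
  exact contDiffAt_pi.2 fun i => h'.clm_apply contDiffAt_const

/-- Row i of `hess` holds the derivatives in direction i, so the derivative of the gradient is v ᵥ*
`hess`; symmetry of second derivatives plays no role. -/
theorem fderiv_grad_dotProduct (h : DifferentiableAt ℝ (grad F) x) (v w : ι → ℝ) :
    fderiv ℝ (grad F) x v ⬝ᵥ w = v ⬝ᵥ (hess F x *ᵥ w) := by
  have h1 : fderiv ℝ (grad F) x v = v ᵥ* hess F x := by
    ext j
    rw [ContinuousLinearMap.apply_eq_sum_single]
    simp only [Finset.sum_apply, Pi.smul_apply, smul_eq_mul, vecMul, dotProduct, hess, of_apply]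
    refine Finset.sum_congr rfl fun i _ => ?_
    rw [(hasFDerivAt_pi'.1 h.hasFDerivAt j).fderiv]
    rfl
  rw [h1, dotProduct_mulVec]

/-- Strong monotonicity of the gradient near a point where the Hessian is positive definite. -/
theorem exists_strongMono_grad (h : ContDiffAt ℝ 2 F x) (hpos : (hess F x).PosDef) :
    ∃ c > 0, ∀ᶠ r in 𝓝[>] (0 : ℝ), ∀ y ∈ Metric.closedBall x r, ∀ z ∈ Metric.closedBall x r,
      c * ‖y - z‖ ^ 2 ≤ (grad F y - grad F z) ⬝ᵥ (y - z) := by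
  obtain ⟨c, hc, hcv⟩ := hpos.exists_mul_norm_sq_le
  have hG := h.grad_of_two
  have hs : HasStrictFDerivAt (grad F) (fderiv ℝ (grad F) x) x :=
    hG.hasStrictFDerivAt one_ne_zero
  obtain ⟨n, hn⟩ : ∃ n : ℝ, n = Fintype.card ι := ⟨_, rfl⟩
  have hn0 : 0 ≤ n := by rw [hn]; positivity
  -- The sup-norm bound on dot products costs a factor n, so this ε keeps the linearization error
  -- below half of the quadratic form; n + 1 avoids division by zero.
  have hε : 0 < c / (2 * (n + 1)) := by positivity
  have hev := hs.isLittleO.def hε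
  rw [nhds_prod_eq] at hev
  obtain ⟨u, hu, hu'⟩ := (Filter.eventually_prod_self_iff'.1 hev)
  obtain ⟨ε, hε0, hball⟩ := Metric.nhds_basis_closedBall.mem_iff.1 hu
  refine ⟨c / 2, by positivity, ?_⟩
  filter_upwards [Ioc_mem_nhdsGT hε0] with r hr y hy z hz
  have hb := hu' y (hball (Metric.closedBall_subset_closedBall hr.2 hy)) z
    (hball (Metric.closedBall_subset_closedBall hr.2 hz))
  have h1 := fderiv_grad_dotProduct (hG.differentiableAt one_ne_zero) (y - z) (y - z)
  have h2 := hcv (y - z)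
  have h3 := abs_dotProduct_le (grad F y - grad F z - fderiv ℝ (grad F) x (y - z)) (y - z)
  rw [sub_dotProduct, h1, ← hn] at h3
  have h4 : n * ‖grad F y - grad F z - fderiv ℝ (grad F) x (y - z)‖ * ‖y - z‖
      ≤ c / 2 * ‖y - z‖ ^ 2 := by
    calc _ ≤ n * (c / (2 * (n + 1)) * ‖y - z‖) * ‖y - z‖ := by gcongr
      _ = (n / (n + 1)) * (c / 2 * ‖y - z‖ ^ 2) := by field_simp
      _ ≤ 1 * (c / 2 * ‖y - z‖ ^ 2) := by
          gcongr
          rw [div_le_one (by positivity)]; linarith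
      _ = _ := one_mul _
  have h5 := (abs_le.1 (h3.trans h4)).1
  linarith

end Grad

/-! ### Lyapunov functions for differential-algebraic systems -/

namespace DAE

variable {ι κ : Type}

/-- Differential part of a state. -/
def diffPart (x : ι ⊕ κ → ℝ) : ι → ℝ := fun i => x (.inl i)

theorem IsSolutionOn.mono {S : DAE ι κ} {J J' : Set ℝ} {x : ℝ → ι ⊕ κ → ℝ}
    (hx : S.IsSolutionOn J x) (h : J' ⊆ J) : S.IsSolutionOn J' x where
  continuousOn := hx.continuousOn.mono h
  mem_dom t ht := hx.mem_dom t (h ht)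
  differential t ht i := (hx.differential t (h ht) i).mono h
  algebraic t ht := hx.algebraic t (h ht)

theorem IsSolutionOn.hasDerivWithinAt {S : DAE ι κ} {J : Set ℝ} {x : ℝ → ι ⊕ κ → ℝ}
    (hx : S.IsSolutionOn J x) {t : ℝ} (ht : t ∈ J) :
    HasDerivWithinAt (fun s => diffPart (x s)) (S.f (x t)) J t :=
  hasDerivWithinAt_pi.2 fun i => hx.differential t ht i

variable [Fintype ι] [Fintype κ]

theorem dist_diffPart_le (x y : ι ⊕ κ → ℝ) : dist (diffPart x) (diffPart y) ≤ dist x y :=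
  (dist_pi_le_iff dist_nonneg).2 fun i => dist_le_pi_dist x y (.inl i)

theorem dotProduct_eq_diffPart {v : ι ⊕ κ → ℝ} (hv : ∀ k, v (.inr k) = 0) (w : ι ⊕ κ → ℝ) :
    v ⬝ᵥ w = diffPart v ⬝ᵥ diffPart w := by
  simp [dotProduct, Fintype.sum_sum_type, hv, diffPart]

variable [DecidableEq ι] [DecidableEq κ]

/-- `H` is a Lyapunov function for the system `S` on the closed ball of radius `r` around `xbar`:
it is strongly convex there, the algebraic equations are the vanishing of its partial derivatives
in the algebraic variables, it is non-increasing along solutions, and it is stationary at every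
state from which it is conserved. -/
structure LyapunovOn (S : DAE ι κ) (H : (ι ⊕ κ → ℝ) → ℝ) (xbar : ι ⊕ κ → ℝ) (r c : ℝ)
    (K : NNReal) : Prop where
  r_pos : 0 < r
  c_pos : 0 < c
  subset_dom : Metric.closedBall xbar r ⊆ S.dom
  differentiableAt : ∀ x ∈ Metric.closedBall xbar r, DifferentiableAt ℝ H x
  lipschitz_grad : LipschitzOnWith K (grad H) (Metric.closedBall xbar r)
  lipschitz_f : LipschitzOnWith K S.f (Metric.closedBall xbar r)
  strongMono : ∀ y ∈ Metric.closedBall xbar r, ∀ z ∈ Metric.closedBall xbar r,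
    c * ‖y - z‖ ^ 2 ≤ (grad H y - grad H z) ⬝ᵥ (y - z)
  grad_eq_zero : grad H xbar = 0
  algebraic_iff : ∀ x ∈ S.dom, S.g x = 0 ↔ ∀ k, grad H x (.inr k) = 0
  dissipation : ∀ x ∈ S.dom, S.g x = 0 → diffPart (grad H x) ⬝ᵥ S.f x ≤ 0
  detectable : ∀ x, S.IsSolutionOn (Ici 0) x →
    (∀ t ≥ 0, diffPart (grad H (x t)) ⬝ᵥ S.f (x t) = 0) → grad H (x 0) = 0

namespace LyapunovOn

variable {S : DAE ι κ} {H : (ι ⊕ κ → ℝ) → ℝ} {xbar : ι ⊕ κ → ℝ} {r c : ℝ} {K : NNReal}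

/-- At consistent states the algebraic components of ∇H vanish, so (∇H x - ∇H y)·(x - y) only sees
the differential variables. It lies between c‖x - y‖² and a multiple of ‖x - y‖ times their
distance; dividing by ‖x - y‖ gives a quantitative implicit function theorem. -/
theorem exists_dist_le (h : S.LyapunovOn H xbar r c K) :
    ∃ C : NNReal, ∀ x ∈ Metric.closedBall xbar r, ∀ y ∈ Metric.closedBall xbar r,
      S.g x = 0 → S.g y = 0 → dist x y ≤ C * dist (diffPart x) (diffPart y) := by
  refine ⟨⟨Fintype.card ι * K / c, by have := h.c_pos; positivity⟩, fun x hx y hy gx gy => ?_⟩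
  rcases eq_or_ne x y with rfl | hne
  · simp
  have hpos : 0 < dist x y := dist_pos.2 hne
  have h1 := h.strongMono x hx y hy
  have gx' := (h.algebraic_iff x (h.subset_dom hx)).1 gx
  have gy' := (h.algebraic_iff y (h.subset_dom hy)).1 gy
  rw [dotProduct_eq_diffPart (by simp [gx', gy']), ← dist_eq_norm] at h1
  have h2 := (le_abs_self _).trans (abs_dotProduct_le (diffPart (grad H x - grad H y))
    (diffPart (x - y)))
  have h3 : ‖diffPart (grad H x - grad H y)‖ ≤ K * dist x y :=
    calc _ = dist (diffPart (grad H x)) (diffPart (grad H y)) := by rw [dist_eq_norm]; rfl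
      _ ≤ dist (grad H x) (grad H y) := dist_diffPart_le _ _
      _ ≤ _ := h.lipschitz_grad.dist_le_mul x hx y hy
  have h4 : ‖diffPart (x - y)‖ = dist (diffPart x) (diffPart y) := by rw [dist_eq_norm]; rfl
  rw [h4] at h2
  have h5 : c * dist x y ^ 2 ≤ Fintype.card ι * (K * dist x y) * dist (diffPart x) (diffPart y) :=
    h1.trans (h2.trans (by gcongr))
  change dist x y ≤ Fintype.card ι * K / c * dist (diffPart x) (diffPart y)
  rw [div_mul_eq_mul_div, le_div_iff₀ h.c_pos]
  nlinarith

/-- Strong monotonicity, integrated along the segment from the critical point `xbar`. -/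
theorem quadratic_le (h : S.LyapunovOn H xbar r c K) {x : ι ⊕ κ → ℝ}
    (hx : x ∈ Metric.closedBall xbar r) : H xbar + c / 2 * dist x xbar ^ 2 ≤ H x := by
  set v := x - xbar with hv
  have hxb : xbar ∈ Metric.closedBall xbar r := Metric.mem_closedBall_self h.r_pos.le
  have hmem : ∀ s ∈ Icc (0 : ℝ) 1, xbar + s • v ∈ Metric.closedBall xbar r := by
    intro s hs
    exact (convex_closedBall xbar r).add_smul_sub_mem hxb hx hs
  have hder : ∀ s ∈ Icc (0 : ℝ) 1, HasDerivAt
      (fun s : ℝ => H (xbar + s • v) - c / 2 * ‖v‖ ^ 2 * s ^ 2)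
      (grad H (xbar + s • v) ⬝ᵥ v - c * ‖v‖ ^ 2 * s) s := by
    intro s hs
    have h1 := (h.differentiableAt _ (hmem s hs)).hasFDerivAt
    have h2 : HasDerivAt (fun s : ℝ => xbar + s • v) v s := by
      simpa using ((hasDerivAt_id s).smul_const v).const_add xbar
    have h3 := h1.comp_hasDerivAt s h2
    rw [fderiv_eq_grad_dotProduct] at h3
    refine (h3.sub ((hasDerivAt_pow 2 s).const_mul (c / 2 * ‖v‖ ^ 2))).congr_deriv ?_
    norm_num
    ring
  have hmono : MonotoneOn (fun s : ℝ => H (xbar + s • v) - c / 2 * ‖v‖ ^ 2 * s ^ 2)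
      (Icc 0 1) := by
    refine monotoneOn_of_deriv_nonneg (convex_Icc 0 1)
      (fun s hs => (hder s hs).continuousAt.continuousWithinAt) (fun s hs =>
        (hder s (interior_subset hs)).differentiableAt.differentiableWithinAt) (fun s hs => ?_)
    rw [(hder s (interior_subset hs)).deriv]
    rw [interior_Icc] at hs
    have h1 := h.strongMono _ (hmem s (Ioo_subset_Icc_self hs)) _ hxb
    rw [h.grad_eq_zero, sub_zero, add_sub_cancel_left, dotProduct_smul, norm_smul,
      Real.norm_of_nonneg hs.1.le, smul_eq_mul] at h1
    have hs0 := hs.1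
    have : s * (c * ‖v‖ ^ 2 * s) ≤ s * (grad H (xbar + s • v) ⬝ᵥ v) := by linarith
    linarith [le_of_mul_le_mul_left this hs0]
  have h01 := hmono (left_mem_Icc.2 zero_le_one) (right_mem_Icc.2 zero_le_one) zero_le_one
  simp only [zero_smul, one_smul, add_zero, hv, add_sub_cancel] at h01
  rw [dist_eq_norm]
  linarith

/-- The chain rule is not immediate, since algebraic variables are only known to be continuous in
time. By `exists_dist_le` their increments are O(s - t), and ∇H has no component in their
directions, so the first-order expansion of H involves only the differential variables. -/
theorem hasDerivWithinAt_comp (h : S.LyapunovOn H xbar r c K) {J : Set ℝ}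
    {x : ℝ → ι ⊕ κ → ℝ} (hx : S.IsSolutionOn J x)
    (hball : ∀ t ∈ J, x t ∈ Metric.closedBall xbar r) {t : ℝ} (ht : t ∈ J) :
    HasDerivWithinAt (fun s => H (x s)) (diffPart (grad H (x t)) ⬝ᵥ S.f (x t)) J t := by
  obtain ⟨C, hC⟩ := h.exists_dist_le
  have hd := hx.hasDerivWithinAt ht
  have hcontx : Tendsto x (𝓝[J] t) (𝓝 (x t)) := hx.continuousOn t ht
  have hH := (h.differentiableAt _ (hball t ht)).hasFDerivAt.isLittleO
  have halg := (h.algebraic_iff _ (hx.mem_dom t ht)).1 (hx.algebraic t ht)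
  have hO1 : (fun s => x s - x t) =O[𝓝[J] t] fun s => diffPart (x s) - diffPart (x t) := by
    refine Asymptotics.IsBigO.of_bound C ?_
    filter_upwards [self_mem_nhdsWithin] with s hs
    rw [← dist_eq_norm, ← dist_eq_norm]
    exact hC _ (hball s hs) _ (hball t ht) (hx.algebraic s hs) (hx.algebraic t ht)
  have hO : (fun s => x s - x t) =O[𝓝[J] t] fun s => s - t :=
    hO1.trans hd.hasFDerivWithinAt.isBigO_sub
  have h1 := (hH.comp_tendsto hcontx).trans_isBigO hO
  rw [hasDerivWithinAt_iff_isLittleO] at hd ⊢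
  have h2 : (fun s => diffPart (grad H (x t)) ⬝ᵥ
      (diffPart (x s) - diffPart (x t) - (s - t) • S.f (x t))) =o[𝓝[J] t] fun s => s - t := by
    refine Asymptotics.IsBigO.trans_isLittleO (Asymptotics.IsBigO.of_bound
      (Fintype.card ι * ‖diffPart (grad H (x t))‖) (Eventually.of_forall fun s => ?_)) hd
    exact abs_dotProduct_le _ _
  refine (h1.add h2).congr_left fun s => ?_
  simp only [Function.comp_apply, fderiv_eq_grad_dotProduct]
  rw [dotProduct_eq_diffPart halg, dotProduct_sub, dotProduct_smul]
  change _ - _ - diffPart (grad H (x t)) ⬝ᵥ (diffPart (x s) - diffPart (x t)) + _ = _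
  ring

theorem antitoneOn (h : S.LyapunovOn H xbar r c K) {J : Set ℝ} (hJ : J.OrdConnected)
    {x : ℝ → ι ⊕ κ → ℝ} (hx : S.IsSolutionOn J x)
    (hball : ∀ t ∈ J, x t ∈ Metric.closedBall xbar r) : AntitoneOn (fun t => H (x t)) J := by
  have hd := fun t (ht : t ∈ J) => h.hasDerivWithinAt_comp hx hball ht
  refine antitoneOn_of_hasDerivWithinAt_nonpos hJ.convex (fun t ht => (hd t ht).continuousWithinAt)
    (fun t ht => (hd t (interior_subset ht)).mono interior_subset) fun t ht => ?_
  exact h.dissipation _ (hx.mem_dom t (interior_subset ht)) (hx.algebraic t (interior_subset ht))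

/-- Solutions that start close to the equilibrium stay close to it. -/
theorem exists_forall_dist_lt (h : S.LyapunovOn H xbar r c K) {ε : ℝ} (hε : 0 < ε) :
    ∃ δ > 0, ∀ (J : Set ℝ) (x : ℝ → ι ⊕ κ → ℝ), J ⊆ Ici 0 → J.OrdConnected → (0 : ℝ) ∈ J →
      S.IsSolutionOn J x → dist (x 0) xbar < δ → ∀ t ∈ J, dist (x t) xbar < ε := by
  wlog hεr : ε ≤ r generalizing ε
  · obtain ⟨δ, hδ, hδ'⟩ := this h.r_pos le_rfl
    exact ⟨δ, hδ, fun J x h1 h2 h3 h4 h5 t ht => (hδ' J x h1 h2 h3 h4 h5 t ht).trans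
      (not_le.1 hεr)⟩
  have hHc : ContinuousAt H xbar :=
    (h.differentiableAt _ (Metric.mem_closedBall_self h.r_pos.le)).continuousAt
  have hlt : H xbar < H xbar + c / 2 * ε ^ 2 := by
    have := h.c_pos
    linarith [show 0 < c / 2 * ε ^ 2 by positivity]
  -- c/2 · ε² is the energy excess that `quadratic_le` requires at distance ε; starting below it
  -- rules out ever reaching that distance.
  obtain ⟨δ, hδ, hδ'⟩ := Metric.eventually_nhds_iff.1 (hHc.eventually (gt_mem_nhds hlt))
  refine ⟨min δ ε, lt_min hδ hε, fun J x hJ hJc h0 hx hx0 t₁ ht₁ => ?_⟩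
  by_contra hcon
  have hsub : Icc 0 t₁ ⊆ J := hJc.out h0 ht₁
  have hcont : ContinuousOn (fun t => dist (x t) xbar) (Icc 0 t₁) :=
    (continuous_id.dist continuous_const).comp_continuousOn (hx.continuousOn.mono hsub)
  have hcomp : IsCompact (Icc 0 t₁ ∩ (fun t => dist (x t) xbar) ⁻¹' Ici ε) :=
    isCompact_Icc.of_isClosed_subset (hcont.preimage_isClosed_of_isClosed isClosed_Icc isClosed_Ici)
      inter_subset_left
  -- T is the first time at distance ε or more. Up to T the solution lies in the ball where H is
  -- known to decrease.
  obtain ⟨T, ⟨hT, hTε⟩, hleast⟩ := hcomp.exists_isLeast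
    ⟨t₁, right_mem_Icc.2 (hJ ht₁), not_lt.1 hcon⟩
  have hlow : ∀ s ∈ Ico 0 T, dist (x s) xbar < ε := by
    intro s hs
    by_contra hs'
    exact absurd (hleast ⟨⟨hs.1, hs.2.le.trans hT.2⟩, not_lt.1 hs'⟩) (not_le.2 hs.2)
  have hT0 : 0 < T := by
    refine lt_of_le_of_ne hT.1 fun he => ?_
    rw [← he] at hTε
    exact absurd (hx0.trans_le (min_le_right _ _)) (not_lt.2 hTε)
  have hle : ∀ s ∈ Icc 0 T, dist (x s) xbar ≤ ε := by
    have hcl : closure (Ico 0 T) = Icc 0 T := closure_Ico hT0.ne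
    intro s hs
    have hc' : ContinuousOn (fun t => dist (x t) xbar) (closure (Ico 0 T)) := by
      rw [hcl]; exact hcont.mono (Icc_subset_Icc_right hT.2)
    exact le_on_closure (fun s hs => (hlow s hs).le) hc' continuousOn_const (hcl ▸ hs)
  have hsubT : Icc 0 T ⊆ J := (Icc_subset_Icc_right hT.2).trans hsub
  have hballT : ∀ s ∈ Icc 0 T, x s ∈ Metric.closedBall xbar r := fun s hs => (hle s hs).trans hεr
  have hanti := h.antitoneOn ordConnected_Icc (hx.mono hsubT) hballT
    (left_mem_Icc.2 hT.1) (right_mem_Icc.2 hT.1) hT.1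
  have hq := h.quadratic_le (hballT T (right_mem_Icc.2 hT.1))
  have hstart := hδ' (hx0.trans_le (min_le_left _ _))
  have : c / 2 * ε ^ 2 ≤ c / 2 * dist (x T) xbar ^ 2 := by
    have := h.c_pos
    gcongr
    exact hTε
  simp only at hanti
  linarith

/-- Near the equilibrium, the algebraic variables are determined by the differential variables. -/
theorem exists_algebraic_solution (h : S.LyapunovOn H xbar r c K) :
    ∃ ρ > 0, ∃ s : (ι → ℝ) → ι ⊕ κ → ℝ, ∀ d ∈ Metric.closedBall (diffPart xbar) ρ,
      s d ∈ Metric.closedBall xbar r ∧ S.g (s d) = 0 ∧ diffPart (s d) = d := by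
  have hr := h.r_pos
  have hc := h.c_pos
  set abar : κ → ℝ := fun k => xbar (.inr k) with habar
  have hxbar : Sum.elim (diffPart xbar) abar = xbar := by ext (i | k) <;> rfl
  have hcont_elim : Continuous fun p : (ι → ℝ) × (κ → ℝ) => (Sum.elim p.1 p.2 : ι ⊕ κ → ℝ) := by
    refine continuous_pi fun j => ?_
    rcases j with i | k
    · exact (continuous_apply i).comp continuous_fst
    · exact (continuous_apply k).comp continuous_snd
  have hmem : ∀ d a, dist d (diffPart xbar) ≤ r → dist a abar ≤ r →
      (Sum.elim d a : ι ⊕ κ → ℝ) ∈ Metric.closedBall xbar r := by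
    intro d a hd ha
    rw [Metric.mem_closedBall, dist_pi_le_iff hr.le]
    rintro (i | k)
    · exact (dist_le_pi_dist d (diffPart xbar) i).trans hd
    · exact (dist_le_pi_dist a abar k).trans ha
  have hHc : ContinuousAt (fun d => H (Sum.elim d abar)) (diffPart xbar) := by
    have h1 : ContinuousAt H (Sum.elim (diffPart xbar) abar) := by
      rw [hxbar]
      exact (h.differentiableAt _ (Metric.mem_closedBall_self hr.le)).continuousAt
    exact ContinuousAt.comp (f := fun d => Sum.elim d abar) h1
      (hcont_elim.comp (continuous_id.prodMk continuous_const)).continuousAt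
  -- The implicit function is found by minimizing H in the algebraic variables. For d near `diffPart
  -- xbar`, the value at `abar` stays below the lower bound c/2 · r² that H obeys on the boundary.
  have hlt : (fun d => H (Sum.elim d abar)) (diffPart xbar) < H xbar + c / 2 * r ^ 2 := by
    simp only [hxbar]
    linarith [show 0 < c / 2 * r ^ 2 by positivity]
  obtain ⟨ρ, hρ, hρ'⟩ := Metric.nhds_basis_closedBall.mem_iff.1 (hHc.eventually (gt_mem_nhds hlt))
  refine ⟨min ρ r, lt_min hρ hr, ?_⟩
  have key : ∀ d, ∃ x : ι ⊕ κ → ℝ, d ∈ Metric.closedBall (diffPart xbar) (min ρ r) →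
      x ∈ Metric.closedBall xbar r ∧ S.g x = 0 ∧ diffPart x = d := by
    intro d
    by_cases hd : d ∈ Metric.closedBall (diffPart xbar) (min ρ r)
    swap
    · exact ⟨0, fun h => absurd h hd⟩
    have hdρ : H (Sum.elim d abar) < H xbar + c / 2 * r ^ 2 :=
      hρ' (Metric.closedBall_subset_closedBall (min_le_left _ _) hd)
    have hdr : dist d (diffPart xbar) ≤ r := le_trans hd (min_le_right _ _)
    have hcd : ContinuousOn (fun a => H (Sum.elim d a)) (Metric.closedBall abar r) := by
      intro a ha
      exact (ContinuousAt.comp (f := fun a => (Sum.elim d a : ι ⊕ κ → ℝ))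
        (h.differentiableAt _ (hmem d a hdr ha)).continuousAt
        (hcont_elim.comp (continuous_const.prodMk continuous_id)).continuousAt).continuousWithinAt
    obtain ⟨a, ha, hmin⟩ := (isCompact_closedBall abar r).exists_isMinOn
      ⟨abar, Metric.mem_closedBall_self hr.le⟩ hcd
    refine ⟨Sum.elim d a, fun _ => ⟨hmem d a hdr ha, ?_, rfl⟩⟩
    -- The minimizer is interior, hence a critical point in the algebraic variables.
    have hain : dist a abar < r := by
      by_contra hge
      have h1 := h.quadratic_le (hmem d a hdr ha)
      have h2 : r ≤ dist (Sum.elim d a : ι ⊕ κ → ℝ) xbar :=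
        (not_lt.1 hge).trans ((dist_pi_le_iff dist_nonneg).2 fun k =>
          dist_le_pi_dist (Sum.elim d a : ι ⊕ κ → ℝ) xbar (.inr k))
      have h3 : H (Sum.elim d a) ≤ H (Sum.elim d abar) := hmin (Metric.mem_closedBall_self hr.le)
      have h4 : c / 2 * r ^ 2 ≤ c / 2 * dist (Sum.elim d a : ι ⊕ κ → ℝ) xbar ^ 2 := by gcongr
      linarith
    refine (h.algebraic_iff _ (h.subset_dom (hmem d a hdr ha))).2 fun k => ?_
    have hloc : IsLocalMin (fun t : ℝ => H (Sum.elim d a + t • Pi.single (.inr k) 1)) 0 := by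
      have hl : IsLocalMin (fun a => H (Sum.elim d a)) a :=
        hmin.isLocalMin (Metric.closedBall_mem_nhds_of_mem hain)
      have hcurve : Continuous fun t : ℝ => a + t • (Pi.single k 1 : κ → ℝ) := by fun_prop
      have hl' : IsLocalMin (fun t : ℝ => H (Sum.elim d (a + t • (Pi.single k 1 : κ → ℝ)))) 0 :=
        IsLocalMin.comp_continuous (f := fun a => H (Sum.elim d a))
          (g := fun t : ℝ => a + t • (Pi.single k 1 : κ → ℝ)) (by simpa using hl)
          hcurve.continuousAt
      convert hl' using 3 with t
      ext (i | j)
      · simp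
      · simp [Pi.single_apply]
    have hderiv : HasDerivAt (fun t : ℝ => H (Sum.elim d a + t • Pi.single (.inr k) 1))
        (fderiv ℝ H (Sum.elim d a) (Pi.single (.inr k) 1)) 0 :=
      (h.differentiableAt _ (hmem d a hdr ha)).hasFDerivAt.hasLineDerivAt _
    exact hloc.hasDerivAt_eq_zero hderiv
  choose s hs using key
  exact ⟨s, hs⟩

end LyapunovOn

end DAE

/-! ### Truncation to a closed ball -/

/-- Coordinatewise projection onto a closed ball for the sup norm. -/
def clamp {ι : Type} (c : ι → ℝ) (ρ : ℝ) (d : ι → ℝ) : ι → ℝ :=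
  fun i => max (min (d i) (c i + ρ)) (c i - ρ)

section Clamp

variable {ι : Type} [Fintype ι] (c : ι → ℝ) {ρ : ℝ}

theorem lipschitzWith_clamp : LipschitzWith 1 (clamp c ρ) := by
  refine LipschitzWith.of_dist_le_mul fun d d' => ?_
  rw [NNReal.coe_one, one_mul, dist_pi_le_iff dist_nonneg]
  intro i
  have h := ((LipschitzWith.id (α := ℝ)).min_const (c i + ρ)).max_const (c i - ρ)
  have h1 := h.dist_le_mul (d i) (d' i)
  rw [NNReal.coe_one, one_mul] at h1
  exact h1.trans (dist_le_pi_dist d d' i)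

theorem clamp_mem (hρ : 0 ≤ ρ) (d : ι → ℝ) : clamp c ρ d ∈ Metric.closedBall c ρ := by
  rw [Metric.mem_closedBall, dist_pi_le_iff hρ]
  intro i
  rw [Real.dist_eq, abs_le]
  have h1 : c i - ρ ≤ clamp c ρ d i := le_max_right _ _
  have h2 : clamp c ρ d i ≤ c i + ρ := max_le (min_le_right _ _) (by linarith)
  constructor <;> linarith

theorem clamp_of_mem {d : ι → ℝ} (hd : d ∈ Metric.closedBall c ρ) : clamp c ρ d = d := by
  ext i
  have h := (dist_le_pi_dist d c i).trans hd
  rw [Real.dist_eq, abs_le] at h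
  rw [clamp, min_eq_left (by linarith), max_eq_left (by linarith)]

end Clamp

/-! ### Reduction to an ordinary differential equation -/

namespace DAE

variable {ι κ : Type} [Fintype ι] [Fintype κ]

/-- A reduction of `S` near `xbar` to an ordinary differential equation with right-hand side `F`;
`s` recovers the state from its differential part. -/
structure ReductionOn (S : DAE ι κ) (xbar : ι ⊕ κ → ℝ) (r ρ : ℝ) (C : NNReal)
    (F : (ι → ℝ) → ι → ℝ) (s : (ι → ℝ) → ι ⊕ κ → ℝ) : Prop where
  ρ_pos : 0 < ρ
  ρ_le : ρ ≤ r
  lipschitz_F : ∃ K : NNReal, LipschitzWith K F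
  bounded_F : ∃ L : NNReal, ∀ d, ‖F d‖ ≤ L
  lipschitz_s : LipschitzOnWith C s (Metric.closedBall (diffPart xbar) ρ)
  s_mem : ∀ d ∈ Metric.closedBall (diffPart xbar) ρ, s d ∈ Metric.closedBall xbar r
  algebraic_s : ∀ d ∈ Metric.closedBall (diffPart xbar) ρ, S.g (s d) = 0
  diffPart_s : ∀ d ∈ Metric.closedBall (diffPart xbar) ρ, diffPart (s d) = d
  s_diffPart : ∀ x ∈ Metric.closedBall xbar ρ, S.g x = 0 → s (diffPart x) = x
  F_eq : ∀ d ∈ Metric.closedBall (diffPart xbar) ρ, F d = S.f (s d)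

namespace ReductionOn

variable {S : DAE ι κ} {xbar : ι ⊕ κ → ℝ} {r ρ : ℝ} {C : NNReal} {F : (ι → ℝ) → ι → ℝ}
  {s : (ι → ℝ) → ι ⊕ κ → ℝ}

theorem hasDerivWithinAt (hR : S.ReductionOn xbar r ρ C F s) {J : Set ℝ} {x : ℝ → ι ⊕ κ → ℝ}
    (hx : S.IsSolutionOn J x) {t : ℝ} (ht : t ∈ J) (hball : x t ∈ Metric.closedBall xbar ρ) :
    HasDerivWithinAt (fun t => diffPart (x t)) (F (diffPart (x t))) J t := by
  rw [hR.F_eq _ ((dist_diffPart_le _ _).trans hball), hR.s_diffPart _ hball (hx.algebraic t ht)]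
  exact hx.hasDerivWithinAt ht

/-- Solutions of the reduced equation give solutions of the differential-algebraic system. -/
theorem isSolutionOn (hR : S.ReductionOn xbar r ρ C F s)
    (hdom : Metric.closedBall xbar r ⊆ S.dom) {J : Set ℝ} {y : ℝ → ι → ℝ}
    (hy : ∀ t, HasDerivAt y (F (y t)) t)
    (hball : ∀ t ∈ J, y t ∈ Metric.closedBall (diffPart xbar) ρ) :
    S.IsSolutionOn J fun t => s (y t) where
  continuousOn := hR.lipschitz_s.continuousOn.comp
    (fun t _ => (hy t).continuousAt.continuousWithinAt) hball
  mem_dom t ht := hdom (hR.s_mem _ (hball t ht))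
  differential t ht i := by
    have h1 := hasDerivAt_pi.1 (hy t) i
    rw [hR.F_eq _ (hball t ht)] at h1
    refine h1.hasDerivWithinAt.congr_of_mem (fun u hu => ?_) ht
    exact congrFun (hR.diffPart_s _ (hball u hu)) i
  algebraic t ht := hR.algebraic_s _ (hball t ht)

/-- Continuous dependence on the initial state. -/
theorem exists_dist_le_mul_exp (hR : S.ReductionOn xbar r ρ C F s) :
    ∃ L : ℝ, ∀ (J : Set ℝ) (x y : ℝ → ι ⊕ κ → ℝ), J.OrdConnected → (0 : ℝ) ∈ J →
      S.IsSolutionOn J x → S.IsSolutionOn J y →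
      (∀ t ∈ J, x t ∈ Metric.closedBall xbar ρ) → (∀ t ∈ J, y t ∈ Metric.closedBall xbar ρ) →
      ∀ t ∈ J, 0 ≤ t → dist (x t) (y t) ≤ C * (dist (x 0) (y 0) * Real.exp (L * t)) := by
  obtain ⟨L, hL⟩ := hR.lipschitz_F
  refine ⟨L, fun J x y hJ h0 hx hy hxb hyb t ht ht0 => ?_⟩
  have hsub : Icc 0 t ⊆ J := hJ.out h0 ht
  have hder : ∀ z : ℝ → ι ⊕ κ → ℝ, S.IsSolutionOn J z →
      (∀ t ∈ J, z t ∈ Metric.closedBall xbar ρ) → ∀ u ∈ Ico 0 t,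
      HasDerivWithinAt (fun u => diffPart (z u)) (F (diffPart (z u))) (Ici u) u := by
    intro z hz hzb u hu
    have hu' : u ∈ J := hsub (Ico_subset_Icc_self hu)
    refine (hR.hasDerivWithinAt hz hu' (hzb u hu')).mono_of_mem_nhdsWithin ?_
    exact mem_of_superset (Icc_mem_nhdsGE hu.2) ((Icc_subset_Icc_left hu.1).trans hsub)
  have hcont : ∀ z : ℝ → ι ⊕ κ → ℝ, S.IsSolutionOn J z →
      ContinuousOn (fun u => diffPart (z u)) (Icc 0 t) := fun z hz u hu =>
    ((hz.hasDerivWithinAt (hsub hu)).continuousWithinAt).mono hsub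
  have hG := dist_le_of_trajectories_ODE (v := fun _ => F) (fun _ => hL) (hcont x hx)
    (hder x hx hxb) (hcont y hy) (hder y hy hyb) (dist_diffPart_le (x 0) (y 0)) t
    (right_mem_Icc.2 ht0)
  rw [sub_zero] at hG
  have h1 := hR.lipschitz_s.dist_le_mul (diffPart (x t)) ((dist_diffPart_le _ _).trans (hxb t ht))
    (diffPart (y t)) ((dist_diffPart_le _ _).trans (hyb t ht))
  rw [hR.s_diffPart _ (hxb t ht) (hx.algebraic t ht),
    hR.s_diffPart _ (hyb t ht) (hy.algebraic t ht)] at h1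
  exact h1.trans (by gcongr)

end ReductionOn

/-! ### Well-posedness and the invariance principle -/

variable [DecidableEq ι] [DecidableEq κ]

namespace LyapunovOn

variable {S : DAE ι κ} {H : (ι ⊕ κ → ℝ) → ℝ} {xbar : ι ⊕ κ → ℝ} {r c : ℝ} {K : NNReal}

/-- Precomposing with `clamp` makes the locally defined field `S.f ∘ s` globally Lipschitz and
bounded without changing it on the ball. `exists_dist_le` makes `s` Lipschitz and, for equal
differential parts, shows that it recovers every nearby consistent state. -/
theorem exists_reductionOn (h : S.LyapunovOn H xbar r c K) :
    ∃ ρ C F s, S.ReductionOn xbar r ρ C F s := by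
  obtain ⟨ρ₀, hρ₀, s, hs₀⟩ := h.exists_algebraic_solution
  obtain ⟨C, hC⟩ := h.exists_dist_le
  set ρ := min ρ₀ r
  have hρ : 0 < ρ := lt_min hρ₀ h.r_pos
  have hs : ∀ d ∈ Metric.closedBall (diffPart xbar) ρ,
      s d ∈ Metric.closedBall xbar r ∧ S.g (s d) = 0 ∧ diffPart (s d) = d := fun d hd =>
    hs₀ d (Metric.closedBall_subset_closedBall (min_le_left _ _) hd)
  have hsub : Metric.closedBall xbar ρ ⊆ Metric.closedBall xbar r :=
    Metric.closedBall_subset_closedBall (min_le_right _ _)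
  have hsL : LipschitzOnWith C s (Metric.closedBall (diffPart xbar) ρ) := by
    refine LipschitzOnWith.of_dist_le_mul fun d hd d' hd' => ?_
    have := hC _ (hs d hd).1 _ (hs d' hd').1 (hs d hd).2.1 (hs d' hd').2.1
    rwa [(hs d hd).2.2, (hs d' hd').2.2] at this
  have hfs : LipschitzOnWith (K * C) (fun d => S.f (s d)) (Metric.closedBall (diffPart xbar) ρ) :=
    h.lipschitz_f.comp hsL fun d hd => (hs d hd).1
  refine ⟨ρ, C, fun d => S.f (s (clamp (diffPart xbar) ρ d)), s, hρ, min_le_right _ _,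
    ⟨K * C * 1, ?_⟩, ?_, hsL, fun d hd => (hs d hd).1, fun d hd => (hs d hd).2.1,
    fun d hd => (hs d hd).2.2, fun x hx hgx => ?_, fun d hd => ?_⟩
  · rw [← lipschitzOnWith_univ]
    exact hfs.comp (lipschitzWith_clamp _).lipschitzOnWith fun d _ => clamp_mem _ hρ.le d
  · obtain ⟨L, hL⟩ := ((isCompact_closedBall (diffPart xbar) ρ).exists_bound_of_continuousOn
      hfs.continuousOn)
    exact ⟨L.toNNReal, fun d => (hL _ (clamp_mem _ hρ.le d)).trans (Real.le_coe_toNNReal L)⟩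
  · have hdx : diffPart x ∈ Metric.closedBall (diffPart xbar) ρ :=
      (dist_diffPart_le x xbar).trans hx
    have := hC _ (hs _ hdx).1 _ (hsub hx) (hs _ hdx).2.1 hgx
    rw [(hs _ hdx).2.2, dist_self, mul_zero] at this
    exact dist_le_zero.1 this
  · rw [clamp_of_mem _ hd]

variable {ρ : ℝ} {C : NNReal} {F : (ι → ℝ) → ι → ℝ} {s : (ι → ℝ) → ι ⊕ κ → ℝ}

/-- The truncated equation has a global solution, which solves the original system as long as it
stays in the ball. The stability estimate prevents it from reaching the boundary. -/
theorem exists_global_solution (h : S.LyapunovOn H xbar r c K)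
    (hR : S.ReductionOn xbar r ρ C F s) :
    ∃ δ > 0, ∀ x₀ ∈ S.consistent, dist x₀ xbar < δ →
      ∃ x : ℝ → ι ⊕ κ → ℝ, S.IsSolutionOn (Ici 0) x ∧ x 0 = x₀ := by
  obtain ⟨δ, hδ, hstay⟩ := h.exists_forall_dist_lt hR.ρ_pos
  refine ⟨min δ ρ, lt_min hδ hR.ρ_pos, fun x₀ hx₀ hdist => ?_⟩
  obtain ⟨K', hK'⟩ := hR.lipschitz_F
  obtain ⟨L, hL⟩ := hR.bounded_F
  obtain ⟨y, hy0, hy⟩ := exists_forall_hasDerivAt_of_lipschitzWith hK' hL (diffPart x₀)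
  have hx₀ρ : dist x₀ xbar < ρ := hdist.trans_le (min_le_right _ _)
  have hs0 : s (y 0) = x₀ := by rw [hy0]; exact hR.s_diffPart _ hx₀ρ.le hx₀.2
  have hin : ∀ t ∈ Ici (0 : ℝ), y t ∈ Metric.closedBall (diffPart xbar) ρ := by
    intro t₁ ht₁
    by_contra hcon
    have hcont : Continuous fun t => dist (y t) (diffPart xbar) :=
      (continuous_iff_continuousAt.2 fun t => (hy t).continuousAt).dist continuous_const
    have hcomp : IsCompact (Icc 0 t₁ ∩ (fun t => dist (y t) (diffPart xbar)) ⁻¹' Ici ρ) :=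
      isCompact_Icc.inter_right (isClosed_Ici.preimage hcont)
    obtain ⟨T, ⟨hT, hTρ⟩, hleast⟩ := hcomp.exists_isLeast
      ⟨t₁, right_mem_Icc.2 ht₁, show ρ ≤ dist (y t₁) (diffPart xbar) from (not_le.1 hcon).le⟩
    have hlow : ∀ u ∈ Ico 0 T, dist (y u) (diffPart xbar) ≤ ρ := by
      intro u hu
      by_contra hu'
      exact absurd (hleast ⟨⟨hu.1, hu.2.le.trans hT.2⟩, (not_le.1 hu').le⟩) (not_le.2 hu.2)
    have hT0 : 0 < T := by
      refine lt_of_le_of_ne hT.1 fun he => ?_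
      rw [← he] at hTρ
      have : ρ ≤ dist (y 0) (diffPart xbar) := hTρ
      rw [hy0] at this
      linarith [dist_diffPart_le x₀ xbar]
    have hle : ∀ u ∈ Icc 0 T, y u ∈ Metric.closedBall (diffPart xbar) ρ := by
      intro u hu
      rw [← closure_Ico hT0.ne] at hu
      exact le_on_closure hlow hcont.continuousOn continuousOn_const hu
    -- So far the curve is a solution on `Icc 0 T` only, which is why stability was stated for
    -- solutions on arbitrary intervals.
    have hsol := hR.isSolutionOn h.subset_dom hy hle
    have := hstay (Icc 0 T) _ Icc_subset_Ici_self ordConnected_Icc (left_mem_Icc.2 hT.1) hsol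
      (by simp only [hs0]; exact hdist.trans_le (min_le_left _ _)) T (right_mem_Icc.2 hT.1)
    have h2 := dist_diffPart_le (s (y T)) xbar
    rw [hR.diffPart_s _ (hle T (right_mem_Icc.2 hT.1))] at h2
    have h3 : ρ ≤ dist (y T) (diffPart xbar) := hTρ
    linarith
  exact ⟨fun t => s (y t), hR.isSolutionOn h.subset_dom hy hin, hs0⟩

/-- LaSalle's argument: H decreases to a limit V, and H equals V along the solution through any
accumulation point p. So H is conserved there, detectability makes p critical, and strong
monotonicity gives p = `xbar`. Then V = H `xbar`, and `quadratic_le` turns convergence of H into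
convergence of the state. -/
theorem exists_forall_tendsto (h : S.LyapunovOn H xbar r c K)
    (hR : S.ReductionOn xbar r ρ C F s) :
    ∃ δ > 0, ∀ x, S.IsSolutionOn (Ici 0) x → dist (x 0) xbar < δ → Tendsto x atTop (𝓝 xbar) := by
  obtain ⟨δ₁, hδ₁, hstay₁⟩ := h.exists_forall_dist_lt hR.ρ_pos
  obtain ⟨δ₂, hδ₂, hexists⟩ := h.exists_global_solution hR
  obtain ⟨L, hdep⟩ := hR.exists_dist_le_mul_exp
  -- Halving leaves room for accumulation points: they lie only in the closed η-ball but must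
  -- satisfy strict bounds by δ₁ and δ₂.
  set η := min δ₁ (min δ₂ ρ) / 2 with hη
  have hmin : 0 < min δ₁ (min δ₂ ρ) := lt_min hδ₁ (lt_min hδ₂ hR.ρ_pos)
  have hη0 : 0 < η := by positivity
  have hη1 : η < δ₁ := by linarith [min_le_left δ₁ (min δ₂ ρ)]
  have hη2 : η < δ₂ := by linarith [min_le_right δ₁ (min δ₂ ρ), min_le_left δ₂ ρ]
  have hη3 : η < ρ := by linarith [min_le_right δ₁ (min δ₂ ρ), min_le_right δ₂ ρ]
  obtain ⟨δ, hδ, hstay⟩ := h.exists_forall_dist_lt hη0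
  refine ⟨δ, hδ, fun x hx hx0 => ?_⟩
  have hxη : ∀ t ∈ Ici (0 : ℝ), dist (x t) xbar < η :=
    hstay (Ici 0) x subset_rfl ordConnected_Ici (mem_Ici.2 le_rfl) hx hx0
  have hηr : Metric.closedBall xbar η ⊆ Metric.closedBall xbar r :=
    Metric.closedBall_subset_closedBall (hη3.le.trans hR.ρ_le)
  have hρr : Metric.closedBall xbar ρ ⊆ Metric.closedBall xbar r :=
    Metric.closedBall_subset_closedBall hR.ρ_le
  have hxr : ∀ t ∈ Ici (0 : ℝ), x t ∈ Metric.closedBall xbar r := fun t ht => hηr (hxη t ht).le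
  have hanti := h.antitoneOn ordConnected_Ici hx hxr
  have hHcont : ContinuousOn H (Metric.closedBall xbar r) := fun z hz =>
    (h.differentiableAt z hz).continuousAt.continuousWithinAt
  -- the limit of `H` along the solution
  obtain ⟨V, hV⟩ : ∃ V, Tendsto (fun t => H (x t)) atTop (𝓝 V) := by
    have hanti' : Antitone fun t => H (x (max t 0)) := fun a b hab =>
      hanti (le_max_right a 0) (le_max_right b 0) (max_le_max_right 0 hab)
    have hbdd : BddBelow (range fun t => H (x (max t 0))) := by
      refine ⟨H xbar, ?_⟩
      rintro _ ⟨t, rfl⟩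
      have := h.quadratic_le (hxr _ (le_max_right t 0))
      have hc := h.c_pos
      linarith [show 0 ≤ c / 2 * dist (x (max t 0)) xbar ^ 2 by positivity]
    refine ⟨_, (tendsto_atTop_ciInf hanti' hbdd).congr' ?_⟩
    filter_upwards [eventually_ge_atTop 0] with t ht
    rw [max_eq_left ht]
  -- an accumulation point
  obtain ⟨p, hp, φ, hφ, hlim⟩ := (isCompact_closedBall xbar η).tendsto_subseq
    (x := fun n : ℕ => x n) fun n => (hxη n (mem_Ici.2 n.cast_nonneg)).le
  have hpr := hηr hp
  have hpdom := h.subset_dom hpr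
  have hgp : S.g p = 0 := by
    rw [h.algebraic_iff p hpdom]
    intro k
    have hgc : Tendsto (fun n => grad H (x (φ n))) atTop (𝓝 (grad H p)) :=
      (h.lipschitz_grad.continuousOn p hpr).tendsto.comp (tendsto_nhdsWithin_iff.2
        ⟨hlim, Eventually.of_forall fun n => hxr _ (mem_Ici.2 (Nat.cast_nonneg _))⟩)
    have h0 : (fun n => grad H (x (φ n)) (.inr k)) = fun _ => 0 := by
      ext n
      have hn : ((φ n : ℕ) : ℝ) ∈ Ici (0 : ℝ) := mem_Ici.2 (Nat.cast_nonneg _)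
      exact (h.algebraic_iff _ (hx.mem_dom _ hn)).1 (hx.algebraic _ hn) k
    have h1 := tendsto_pi_nhds.1 hgc (.inr k)
    rw [h0] at h1
    exact (tendsto_nhds_unique h1 tendsto_const_nhds)
  obtain ⟨y, hy, hy0⟩ := hexists p ⟨hpdom, hgp⟩ (lt_of_le_of_lt hp hη2)
  have hyρ : ∀ t ∈ Ici (0 : ℝ), dist (y t) xbar < ρ :=
    hstay₁ (Ici 0) y subset_rfl ordConnected_Ici (mem_Ici.2 le_rfl) hy
      (by rw [hy0]; exact lt_of_le_of_lt hp hη1)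
  -- `H` is conserved along the solution through the accumulation point
  have hconst : ∀ t ∈ Ici (0 : ℝ), H (y t) = V := by
    intro t ht
    have hshift : ∀ n : ℕ, S.IsSolutionOn (Ici 0) fun u => x (u + n) := by
      intro n
      have hmaps : ∀ u ∈ Ici (0 : ℝ), u + n ∈ Ici (0 : ℝ) := fun u hu =>
        mem_Ici.2 (add_nonneg hu n.cast_nonneg)
      refine ⟨hx.continuousOn.comp (by fun_prop) hmaps, fun u hu => hx.mem_dom _ (hmaps u hu),
        fun u hu i => ?_, fun u hu => hx.algebraic _ (hmaps u hu)⟩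
      have h1 := hx.differential _ (hmaps u hu) i
      have h2 : HasDerivWithinAt (fun u : ℝ => u + n) 1 (Ici 0) u :=
        ((hasDerivAt_id u).add_const (n : ℝ)).hasDerivWithinAt
      simpa [Function.comp_def] using h1.comp u h2 hmaps
    -- Time shifts of x are solutions starting near p, so at a fixed time t they converge to the
    -- solution through p.
    have hconv : Tendsto (fun n => x (t + (φ n : ℕ))) atTop (𝓝 (y t)) := by
      rw [tendsto_iff_dist_tendsto_zero]
      have hb : ∀ n, dist (x (t + (φ n : ℕ))) (y t)
          ≤ C * (dist (x (φ n : ℕ)) p * Real.exp (L * t)) := by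
        intro n
        have := hdep (Ici 0) (fun u => x (u + (φ n : ℕ))) y ordConnected_Ici (mem_Ici.2 le_rfl)
          (hshift _) hy (fun u hu => (hxη _ (mem_Ici.2 (add_nonneg hu
            (Nat.cast_nonneg _)))).le.trans hη3.le)
          (fun u hu => (hyρ u hu).le) t ht ht
        simpa [hy0] using this
      have h0 : Tendsto (fun n => C * (dist (x (φ n : ℕ)) p * Real.exp (L * t))) atTop (𝓝 0) := by
        have := ((tendsto_iff_dist_tendsto_zero.1 hlim).mul_const (Real.exp (L * t))).const_mul
          (C : ℝ)
        simpa using this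
      exact squeeze_zero (fun _ => dist_nonneg) hb h0
    have hyr : y t ∈ Metric.closedBall xbar r := hρr (hyρ t ht).le
    have hH1 : Tendsto (fun n => H (x (t + (φ n : ℕ)))) atTop (𝓝 (H (y t))) :=
      ((h.differentiableAt _ hyr).continuousAt.tendsto).comp hconv
    have hH2 : Tendsto (fun n => H (x (t + (φ n : ℕ)))) atTop (𝓝 V) :=
      hV.comp (tendsto_atTop_add_const_left _ t
        (tendsto_natCast_atTop_atTop.comp hφ.tendsto_atTop))
    exact tendsto_nhds_unique hH1 hH2
  have hgrad : grad H p = 0 := by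
    rw [← hy0]
    refine h.detectable y hy fun t ht => ?_
    have h1 := h.hasDerivWithinAt_comp hy (fun t ht => hρr (hyρ t ht).le) ht
    have h2 : HasDerivWithinAt (fun t => H (y t)) 0 (Ici 0) t :=
      (hasDerivWithinAt_const t (Ici (0 : ℝ)) V).congr_of_mem hconst ht
    exact (uniqueDiffOn_Ici (0 : ℝ) t ht).eq_deriv _ h1 h2
  have hpx : p = xbar := by
    have h1 := h.strongMono p hpr xbar (Metric.mem_closedBall_self h.r_pos.le)
    rw [hgrad, h.grad_eq_zero, sub_zero, zero_dotProduct] at h1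
    have h2 : ‖p - xbar‖ ^ 2 = 0 := le_antisymm (by have := h.c_pos; nlinarith) (by positivity)
    exact sub_eq_zero.1 (norm_eq_zero.1 (pow_eq_zero_iff two_ne_zero |>.1 h2))
  have hVx : V = H xbar := by
    rw [← hconst 0 (mem_Ici.2 le_rfl), hy0, hpx]
  rw [tendsto_iff_dist_tendsto_zero]
  have hsq : Tendsto (fun t => dist (x t) xbar ^ 2) atTop (𝓝 0) := by
    have h0 : Tendsto (fun t => 2 / c * (H (x t) - H xbar)) atTop (𝓝 0) := by
      simpa [hVx] using (hV.sub_const (H xbar)).const_mul (2 / c)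
    refine tendsto_of_tendsto_of_tendsto_of_le_of_le' tendsto_const_nhds h0
      (Eventually.of_forall fun _ => by positivity) ?_
    filter_upwards [eventually_ge_atTop 0] with t ht
    have := h.quadratic_le (hxr t ht)
    have hc := h.c_pos
    rw [div_mul_eq_mul_div, le_div_iff₀ hc]
    linarith
  have := hsq.sqrt
  simpa [Real.sqrt_sq dist_nonneg] using this

/-- Local asymptotic stability from a Lyapunov function and the invariance principle. -/
theorem locallyAsymptoticallyStable (h : S.LyapunovOn H xbar r c K)
    (heq : S.IsEquilibrium xbar) : S.LocallyAsymptoticallyStable xbar := by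
  obtain ⟨ρ, C, F, s, hR⟩ := h.exists_reductionOn
  refine ⟨heq, ?_, fun ε hε => ?_, h.exists_forall_tendsto hR⟩
  · obtain ⟨δ₁, hδ₁, hstay⟩ := h.exists_forall_dist_lt hR.ρ_pos
    obtain ⟨δ₂, hδ₂, hexists⟩ := h.exists_global_solution hR
    obtain ⟨L, hdep⟩ := hR.exists_dist_le_mul_exp
    refine ⟨min δ₁ δ₂, lt_min hδ₁ hδ₂, fun x₀ hx₀ hdist => ?_⟩
    obtain ⟨x, hx, hx0⟩ := hexists x₀ hx₀ (hdist.trans_le (min_le_right _ _))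
    refine ⟨x, hx, hx0, fun J y hJ hJc h0 hy hy0 t ht => ?_⟩
    have hd1 := hdist.trans_le (min_le_left _ _)
    -- Uniqueness is continuous dependence with equal initial states; stability keeps both solutions
    -- in the ball where it applies.
    have := hdep J y x hJc h0 hy (hx.mono hJ)
      (fun u hu => (hstay J y hJ hJc h0 hy (by rwa [hy0]) u hu).le)
      (fun u hu => (hstay (Ici 0) x subset_rfl ordConnected_Ici (mem_Ici.2 le_rfl) hx
        (by rwa [hx0]) u (hJ hu)).le) t ht (hJ ht)
    rw [hx0, hy0, dist_self, zero_mul, mul_zero] at this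
    exact dist_le_zero.1 this
  · obtain ⟨δ, hδ, hstay⟩ := h.exists_forall_dist_lt hε
    exact ⟨δ, hδ, fun x hx hx0 t ht => hstay (Ici 0) x subset_rfl ordConnected_Ici
      (mem_Ici.2 le_rfl) hx hx0 t ht⟩

end LyapunovOn

/-- An equilibrium is locally asymptotically stable if some function with positive definite
Hessian there generates the algebraic equations, is non-increasing along solutions, and is
stationary at every state from which it is conserved. -/
theorem locallyAsymptoticallyStable_of_lyapunov {S : DAE ι κ} {H : (ι ⊕ κ → ℝ) → ℝ}
    {xbar : ι ⊕ κ → ℝ} (hdom : IsOpen S.dom) (heq : S.IsEquilibrium xbar)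
    (hH : ∀ x ∈ S.dom, ContDiffAt ℝ 2 H x) (hf : ContDiffAt ℝ 1 S.f xbar)
    (hess_pos : (hess H xbar).PosDef) (grad_zero : grad H xbar = 0)
    (algebraic_iff : ∀ x ∈ S.dom, S.g x = 0 ↔ ∀ k, grad H x (.inr k) = 0)
    (dissipation : ∀ x ∈ S.dom, S.g x = 0 → diffPart (grad H x) ⬝ᵥ S.f x ≤ 0)
    (detectable : ∀ x, S.IsSolutionOn (Ici 0) x →
      (∀ t ≥ 0, diffPart (grad H (x t)) ⬝ᵥ S.f (x t) = 0) → grad H (x 0) = 0) :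
    S.LocallyAsymptoticallyStable xbar := by
  obtain ⟨c, hc, hmono⟩ := exists_strongMono_grad (hH xbar heq.1) hess_pos
  obtain ⟨K₁, u₁, hu₁, hK₁⟩ :=
    ((hH xbar heq.1).grad_of_two.hasStrictFDerivAt one_ne_zero).exists_lipschitzOnWith
  obtain ⟨K₂, u₂, hu₂, hK₂⟩ := (hf.hasStrictFDerivAt one_ne_zero).exists_lipschitzOnWith
  obtain ⟨ε, hε, hball⟩ := Metric.nhds_basis_closedBall.mem_iff.1
    (inter_mem (inter_mem hu₁ hu₂) (hdom.mem_nhds heq.1))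
  obtain ⟨r, hr, hrε⟩ := (hmono.and (Ioc_mem_nhdsGT hε)).exists
  have hsub := (Metric.closedBall_subset_closedBall (x := xbar) hrε.2).trans hball
  have hL : S.LyapunovOn H xbar r c (max K₁ K₂) :=
    { r_pos := hrε.1
      c_pos := hc
      subset_dom := fun x hx => (hsub hx).2
      differentiableAt := fun x hx => (hH x (hsub hx).2).differentiableAt two_ne_zero
      lipschitz_grad := (hK₁.mono fun x hx => (hsub hx).1.1).weaken (le_max_left _ _)
      lipschitz_f := (hK₂.mono fun x hx => (hsub hx).1.2).weaken (le_max_right _ _)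
      strongMono := hr
      grad_eq_zero := grad_zero
      algebraic_iff := algebraic_iff
      dissipation := dissipation
      detectable := detectable }
  exact hL.locallyAsymptoticallyStable heq

end DAE

/-! ### Linear algebra of incidence matrices -/

/-- A matrix with one column less than it has rows is injective if its left kernel consists of
constant vectors. -/
theorem eq_zero_of_mulVec_eq_zero {ng nl : ℕ} {D : Matrix (Bus ng nl) (Fin (ng + nl - 1)) ℝ}
    (hD : LinearMap.ker (Dᵀ).mulVecLin ≤ Submodule.span ℝ {fun _ => (1 : ℝ)})
    {w : Fin (ng + nl - 1) → ℝ} (hw : D *ᵥ w = 0) : w = 0 := by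
  have h1 : Module.finrank ℝ (LinearMap.ker (Dᵀ).mulVecLin) ≤ 1 :=
    (Submodule.finrank_mono hD).trans ((finrank_span_le_card _).trans (by simp))
  have h2 := LinearMap.finrank_range_add_finrank_ker (Dᵀ).mulVecLin
  have h3 : LinearMap.range (Dᵀ).mulVecLin = ⊤ := by
    refine Submodule.eq_top_of_finrank_eq (le_antisymm (Submodule.finrank_le _) ?_)
    simp only [Module.finrank_fintype_fun_eq_card, Fintype.card_sum, Fintype.card_fin] at h2 ⊢
    omega
  -- By rank-nullity Dᵀ is surjective. Writing w = Dᵀu gives w·w = (Dw)·u = 0.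
  obtain ⟨u, hu⟩ := LinearMap.range_eq_top.1 h3 w
  have h4 : w ⬝ᵥ w = 0 := by
    nth_rewrite 2 [← hu]
    rw [mulVecLin_apply, dotProduct_mulVec, vecMul_transpose, hw, zero_dotProduct]
  exact dotProduct_self_eq_zero.1 h4

/-- A vector in the left kernel takes equal values at the ends of each edge, hence along every walk,
and any two nodes are joined by one. -/
theorem IsTreeIncidence.ker_transpose_le {ng nl : ℕ}
    {D : Matrix (Bus ng nl) (Fin (ng + nl - 1)) ℝ} (hD : IsTreeIncidence D) :
    LinearMap.ker (Dᵀ).mulVecLin ≤ Submodule.span ℝ {fun _ => (1 : ℝ)} := by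
  obtain ⟨T, tail, head, hT, hbij, hD⟩ := hD
  intro u hu
  have hedge : ∀ k, u (head k) = u (tail k) := by
    intro k
    have h := congrFun (LinearMap.mem_ker.1 hu) k
    simp only [mulVecLin_apply, mulVec, dotProduct, transpose_apply, hD, sub_mul, ite_mul, one_mul,
      zero_mul, Finset.sum_sub_distrib, Finset.sum_ite_eq', Finset.mem_univ, if_true,
      Pi.zero_apply] at h
    linarith
  have hadj : ∀ i j, T.Adj i j → u i = u j := by
    intro i j hij
    obtain ⟨k, -, hk⟩ := hbij.surjOn (show s(i, j) ∈ T.edgeSet from hij)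
    rcases Sym2.eq_iff.1 hk with ⟨h1, h2⟩ | ⟨h1, h2⟩
    · rw [← h1, ← h2, hedge]
    · rw [← h1, ← h2, hedge]
  have hwalk : ∀ i j, u i = u j := by
    intro i j
    obtain ⟨w⟩ := hT.connected.preconnected i j
    induction w with
    | nil => rfl
    | cons hij _ ih => exact (hadj _ _ hij).trans ih
  obtain ⟨i₀⟩ := hT.connected.nonempty
  refine Submodule.mem_span_singleton.2 ⟨u i₀, ?_⟩
  ext i
  simp [hwalk i i₀]

/-- Every column has one +1 and one -1, up to cancellation, and so sums to zero. -/
theorem IsTreeIncidence.sum_mulVec {V K : Type} [Fintype V] [DecidableEq V] [Fintype K]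
    {D : Matrix V K ℝ} (hD : IsTreeIncidence D) (w : K → ℝ) : ∑ i, (D *ᵥ w) i = 0 := by
  obtain ⟨T, tail, head, hT, hbij, hD⟩ := hD
  simp only [mulVec, dotProduct]
  rw [Finset.sum_comm]
  refine Finset.sum_eq_zero fun k _ => ?_
  rw [← Finset.sum_mul]
  simp [hD]

/-! ### Calculus of gradients -/

section Grad

variable {ι : Type} [Fintype ι] [DecidableEq ι] {F G : (ι → ℝ) → ℝ} {x : ι → ℝ}

theorem grad_add (hF : DifferentiableAt ℝ F x) (hG : DifferentiableAt ℝ G x) :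
    grad (fun y => F y + G y) x = grad F x + grad G x := by
  exact (hF.hasFDerivAt.add hG.hasFDerivAt).grad_eq

/-- A partial derivative as the derivative along a coordinate line. -/
theorem grad_apply_of_hasDerivAt (hF : DifferentiableAt ℝ F x) {i : ι} {v : ℝ}
    (h : HasDerivAt (fun t : ℝ => F (x + t • Pi.single i 1)) v 0) : grad F x i = v :=
  (hF.hasFDerivAt.hasLineDerivAt (Pi.single i 1)).unique h

theorem grad_apply_eq_zero (hF : DifferentiableAt ℝ F x) {i : ι}
    (h : ∀ t : ℝ, F (x + t • Pi.single i 1) = F x) : grad F x i = 0 :=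
  grad_apply_of_hasDerivAt hF (by simpa only [h] using hasDerivAt_const (0 : ℝ) (F x))

theorem contDiff_shifted {n : WithTop ℕ∞} (hF : ContDiff ℝ n F) (xbar : ι → ℝ) :
    ContDiff ℝ n (shifted F xbar) := by
  unfold shifted dotProduct
  fun_prop

theorem grad_shifted (hF : Differentiable ℝ F) (xbar x : ι → ℝ) :
    grad (shifted F xbar) x = grad F x - grad F xbar := by
  have hlin : HasFDerivAt (fun y : ι → ℝ => (y - xbar) ⬝ᵥ grad F xbar) (fderiv ℝ F xbar) x := by
    have h : (fun y : ι → ℝ => (y - xbar) ⬝ᵥ grad F xbar)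
        = fun y => fderiv ℝ F xbar (y - xbar) := by
      ext y
      rw [fderiv_eq_grad_dotProduct, dotProduct_comm]
    rw [h]
    exact (fderiv ℝ F xbar).hasFDerivAt.comp x ((hasFDerivAt_id x).sub_const xbar)
  exact (((hF x).hasFDerivAt.sub hlin).sub_const (F xbar)).grad_eq

/-- On the line through x and y this is strict monotonicity of the derivative of a strictly convex
function of one variable. -/
theorem StrictConvexOn.grad_sub_dotProduct_pos (hF : StrictConvexOn ℝ univ F)
    (hd : Differentiable ℝ F) {y : ι → ℝ} (hne : x ≠ y) :
    0 < (grad F x - grad F y) ⬝ᵥ (x - y) := by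
  have hder : ∀ t : ℝ, HasDerivAt (fun t : ℝ => F (y + t • (x - y)))
      (grad F (y + t • (x - y)) ⬝ᵥ (x - y)) t := by
    intro t
    rw [← fderiv_eq_grad_dotProduct]
    refine (hd _).hasFDerivAt.comp_hasDerivAt t ?_
    simpa using ((hasDerivAt_id t).smul_const (x - y)).const_add y
  have hconv : StrictConvexOn ℝ univ fun t : ℝ => F (y + t • (x - y)) := by
    refine ⟨convex_univ, fun s _ t _ hst a b ha hb hab => ?_⟩
    have hne' : y + s • (x - y) ≠ y + t • (x - y) := by
      intro h
      have h1 : (s - t) • (x - y) = 0 := by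
        rw [sub_smul, sub_eq_zero]; exact add_left_cancel h
      rcases smul_eq_zero.1 h1 with h2 | h2
      · exact hst (sub_eq_zero.1 h2)
      · exact hne (sub_eq_zero.1 h2)
    have h := hF.2 (mem_univ _) (mem_univ _) hne' ha hb hab
    convert h using 2
    rw [smul_add, smul_add, add_add_add_comm, ← add_smul, hab, one_smul, smul_smul, smul_smul,
      ← add_smul]
    rfl
  have hmono := hconv.strictMonoOn_deriv fun t _ => (hder t).differentiableAt
  have h01 := hmono (mem_univ 0) (mem_univ 1) zero_lt_one
  rw [(hder 0).deriv, (hder 1).deriv] at h01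
  simp only [zero_smul, add_zero, one_smul, add_sub_cancel] at h01
  rw [sub_dotProduct]
  linarith

end Grad

/-! ### Smoothness and gradients of the energy functions -/

namespace Model

variable {ng nl mc : ℕ} (S : Model ng nl mc)

theorem contDiff_Hp {n : WithTop ℕ∞} : ContDiff ℝ n S.Hp := by
  have hE : ∀ i, ContDiff ℝ n fun x : State ng nl mc => xE x i := by
    rintro (i | i)
    · exact contDiff_apply ℝ ℝ _
    · exact contDiff_apply ℝ ℝ _
  have hang : ∀ i, ContDiff ℝ n fun x : State ng nl mc => S.angle (xPhi x) i := by
    intro i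
    unfold angle mulVec dotProduct xPhi
    fun_prop
  unfold Hp xP xEg
  fun_prop

theorem contDiff_Hc {n : WithTop ℕ∞} : ContDiff ℝ n S.Hc := by
  unfold Hc mulVec dotProduct xC
  fun_prop

theorem xC_grad_Hp (x : State ng nl mc) : xC (grad S.Hp x) = 0 := by
  ext i
  refine grad_apply_eq_zero (S.contDiff_Hp.differentiable one_ne_zero x) fun t => ?_
  have h1 : xP (x + t • Pi.single (.inl (.inl i)) 1) = xP x := by ext j; simp [xP]
  have h2 : xEg (x + t • Pi.single (.inl (.inl i)) 1) = xEg x := by ext j; simp [xEg]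
  have h3 : xEl (x + t • Pi.single (.inl (.inl i)) 1) = xEl x := by ext j; simp [xEl]
  have h4 : xPhi (x + t • Pi.single (.inl (.inl i)) 1) = xPhi x := by ext j; simp [xPhi]
  simp only [Hp, xE, h1, h2, h3, h4]

theorem xP_grad_Hp (x : State ng nl mc) : xP (grad S.Hp x) = S.omegaG x := by
  ext i
  refine grad_apply_of_hasDerivAt (S.contDiff_Hp.differentiable one_ne_zero x) ?_
  set e : State ng nl mc := Pi.single (.inl (.inr (.inr (.inl i)))) 1 with he
  have h1 : ∀ (t : ℝ) j, xP (x + t • e) j = xP x j + t * (if j = i then 1 else 0) := by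
    intro t j; simp [xP, he, Pi.single_apply]
  have h2 : ∀ t : ℝ, xEg (x + t • e) = xEg x := by intro t; ext j; simp [xEg, he]
  have h3 : ∀ t : ℝ, xEl (x + t • e) = xEl x := by intro t; ext j; simp [xEl, he]
  have h4 : ∀ t : ℝ, xPhi (x + t • e) = xPhi x := by intro t; ext j; simp [xPhi, he]
  simp only [Hp, xE, h1, h2, h3, h4]
  have hj : ∀ j, HasDerivAt (fun t : ℝ => (S.M j)⁻¹ * (xP x j + t * (if j = i then 1 else 0)) ^ 2
      + (xEg x j - S.Ef j) ^ 2 / (S.Xd j - S.Xd' j))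
      (if j = i then 2 * ((S.M i)⁻¹ * xP x i) else 0) 0 := by
    intro j
    have h := ((((hasDerivAt_id (0 : ℝ)).mul_const (if j = i then (1 : ℝ) else 0)).const_add
      (xP x j)).pow 2).const_mul (S.M j)⁻¹ |>.add_const
        ((xEg x j - S.Ef j) ^ 2 / (S.Xd j - S.Xd' j))
    refine h.congr_deriv ?_
    split_ifs with hji
    · subst hji
      simp
      ring
    · simp
  have hsum := (((HasDerivAt.fun_sum fun j (_ : j ∈ Finset.univ) => hj j).const_mul
    (1 / 2 : ℝ)).add_const (1 / 2 * ∑ i, S.Bself i *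
      (Sum.elim (xEg x) (xEl x) : Bus ng nl → ℝ) i ^ 2)).sub_const
    (open Classical in 1 / 2 * ∑ i, ∑ j with S.graph.Adj i j, S.B i j *
      (Sum.elim (xEg x) (xEl x) : Bus ng nl → ℝ) i * (Sum.elim (xEg x) (xEl x) : Bus ng nl → ℝ) j *
      Real.cos (S.angle (xPhi x) i - S.angle (xPhi x) j))
  refine hsum.congr_deriv ?_
  simp [omegaG]

theorem transpose_τc (hS : S.Standing) : S.τcᵀ = S.τc := by
  have h : ∀ {n : Type} [Fintype n] {A : Matrix n n ℝ}, A.PosDef → Aᵀ = A := fun hA => by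
    simpa using hA.isHermitian.eq
  simp [τc, fromBlocks_transpose, h hS.τg_pos, h hS.τl_pos, h hS.τv_pos, h hS.τlamg_pos,
    h hS.τlaml_pos]

theorem isUnit_det_τc (hS : S.Standing) : IsUnit S.τc.det := by
  simp only [τc, det_fromBlocks_zero₂₁, isUnit_iff_ne_zero]
  have := hS.τg_pos.det_pos.ne'
  have := hS.τl_pos.det_pos.ne'
  have := hS.τv_pos.det_pos.ne'
  have := hS.τlamg_pos.det_pos.ne'
  have := hS.τlaml_pos.det_pos.ne'
  simp_all

theorem τc_mulVec_zc (hS : S.Standing) (x : State ng nl mc) : S.τc *ᵥ S.zc x = xC x := by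
  rw [zc, mulVec_mulVec, mul_nonsing_inv _ (S.isUnit_det_τc hS), one_mulVec]

theorem τc_mulVec (w : CIdx ng nl mc → ℝ) :
    S.τc *ᵥ w = colC (S.τg *ᵥ cG w) (S.τl *ᵥ cL w) (S.τv *ᵥ cV w) (S.τlamg *ᵥ cLamG w)
      (S.τlaml *ᵥ cLamL w) := by
  simp only [τc, fromBlocks_mulVec, zero_mulVec, add_zero, zero_add]
  rfl

/-- Symmetry of τ_c⁻¹ merges the two linear terms in the exact quadratic expansion of H_c along a
coordinate line. -/
theorem xC_grad_Hc (hS : S.Standing) (x : State ng nl mc) : xC (grad S.Hc x) = S.zc x := by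
  ext i
  refine grad_apply_of_hasDerivAt (S.contDiff_Hc.differentiable one_ne_zero x) ?_
  have hsymm : ((S.τc)⁻¹)ᵀ = (S.τc)⁻¹ := by rw [transpose_nonsing_inv, S.transpose_τc hS]
  have h1 : ∀ t : ℝ, xC (x + t • Pi.single (.inl (.inl i)) 1) = xC x + t • Pi.single i 1 := by
    intro t; ext j; simp [xC, Pi.single_apply]
  have h2 : ∀ t : ℝ, S.Hc (x + t • Pi.single (.inl (.inl i)) 1) =
      S.Hc x + t * S.zc x i + t ^ 2 * (1 / 2 * ((S.τc)⁻¹ *ᵥ Pi.single i 1) i) := by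
    intro t
    have h3 : xC x ⬝ᵥ ((S.τc)⁻¹ *ᵥ Pi.single i 1) = S.zc x i := by
      rw [← hsymm, dotProduct_transpose_mulVec, single_one_dotProduct, zc]
    have h4 : (Pi.single i 1 : CIdx ng nl mc → ℝ) ⬝ᵥ ((S.τc)⁻¹ *ᵥ xC x) = S.zc x i := by
      rw [single_one_dotProduct, zc]
    simp only [Hc, h1, mulVec_add, mulVec_smul, add_dotProduct, dotProduct_add, smul_dotProduct,
      dotProduct_smul, h3, h4, smul_eq_mul, single_one_dotProduct]
    ring
  simp only [h2]
  have h := (((hasDerivAt_id (0 : ℝ)).mul_const (S.zc x i)).const_add (S.Hc x)).add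
    ((hasDerivAt_pow 2 (0 : ℝ)).mul_const (1 / 2 * ((S.τc)⁻¹ *ᵥ Pi.single i 1) i))
  refine h.congr_deriv ?_
  simp

theorem grad_Hc_eq_zero (x : State ng nl mc) {j : XIdx ng nl mc}
    (hj : ∀ i, j ≠ .inl (.inl i)) : grad S.Hc x j = 0 := by
  refine grad_apply_eq_zero (S.contDiff_Hc.differentiable one_ne_zero x) fun t => ?_
  have h1 : xC (x + t • Pi.single j 1) = xC x := by
    ext i
    simp [xC, (hj i).symm]
  simp only [Hc, h1]

theorem contDiffAt_Habar {n : WithTop ℕ∞} (xbar : State ng nl mc) {x : State ng nl mc}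
    (hx : ∀ i, 0 < xEl x i) : ContDiffAt ℝ n (S.Habar xbar) x := by
  have hl : ∀ i, ContDiffAt ℝ n (fun x : State ng nl mc => Real.log (xEl x i)) x := fun i =>
    (contDiff_apply ℝ ℝ _).contDiffAt.log (hx i).ne'
  have he : ∀ i, ContDiff ℝ n (fun x : State ng nl mc => xEl x i) := fun i => contDiff_apply ℝ ℝ _
  unfold Habar dotProduct
  fun_prop

theorem grad_Habar_inl (xbar : State ng nl mc) {x : State ng nl mc} (hx : ∀ i, 0 < xEl x i)
    (j : DIdx ng nl mc) : grad (S.Habar xbar) x (.inl j) = 0 := by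
  refine grad_apply_eq_zero ((S.contDiffAt_Habar xbar hx).differentiableAt one_ne_zero) fun t => ?_
  have h1 : xEl (x + t • Pi.single (.inl j) 1) = xEl x := by ext i; simp [xEl]
  simp only [Habar, h1]

theorem xEl_grad_Habar (xbar : State ng nl mc) {x : State ng nl mc} (hx : ∀ i, 0 < xEl x i)
    (i : Fin nl) :
    grad (S.Habar xbar) x (.inr i) = xEl (grad S.Hp xbar) i - S.Q i / xEl x i := by
  refine grad_apply_of_hasDerivAt
    ((S.contDiffAt_Habar xbar hx).differentiableAt one_ne_zero) ?_
  have h1 : ∀ (t : ℝ) j, xEl (x + t • Pi.single (.inr i) 1) j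
      = xEl x j + t * (if j = i then 1 else 0) := by
    intro t j; simp [xEl, Pi.single_apply]
  simp only [Habar, dotProduct, h1]
  have hj : ∀ j, HasDerivAt (fun t : ℝ => xEl x j + t * (if j = i then 1 else 0))
      (if j = i then 1 else 0) 0 := by
    intro j
    simpa using ((hasDerivAt_id (0 : ℝ)).mul_const (if j = i then (1 : ℝ) else 0)).const_add
      (xEl x j)
  have hlog : ∀ j, HasDerivAt
      (fun t : ℝ => Real.log (xEl x j + t * (if j = i then 1 else 0)))
      ((if j = i then 1 else 0) / xEl x j) 0 := by
    intro j
    have := (hj j).log (by simpa using (hx j).ne')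
    simpa using this
  have hsum := (HasDerivAt.fun_sum fun j (_ : j ∈ Finset.univ) =>
    (hj j).mul_const (xEl (grad S.Hp xbar) j)).sub
    (HasDerivAt.fun_sum fun j (_ : j ∈ Finset.univ) => (hlog j).const_mul (S.Q j))
  refine hsum.congr_deriv ?_
  simp [div_eq_mul_inv]

theorem xEl_pos {x : State ng nl mc} (hx : ∀ i, 0 < xE x i) (i : Fin nl) : 0 < xEl x i :=
  hx (.inr i)

theorem contDiffAt_Hbar {n : WithTop ℕ∞} (xbar : State ng nl mc) {x : State ng nl mc}
    (hx : ∀ i, 0 < xE x i) : ContDiffAt ℝ n (S.Hbar xbar) x :=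
  ((contDiff_shifted S.contDiff_Hp xbar).contDiffAt.add
    (S.contDiffAt_Habar xbar (xEl_pos hx))).add (contDiff_shifted S.contDiff_Hc xbar).contDiffAt

theorem grad_Hbar (xbar : State ng nl mc) {x : State ng nl mc} (hx : ∀ i, 0 < xE x i) :
    grad (S.Hbar xbar) x =
      (grad S.Hp x - grad S.Hp xbar) + grad (S.Habar xbar) x + (grad S.Hc x - grad S.Hc xbar) := by
  have hp : Differentiable ℝ S.Hp := S.contDiff_Hp.differentiable one_ne_zero
  have hc : Differentiable ℝ S.Hc := S.contDiff_Hc.differentiable one_ne_zero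
  have hp' : DifferentiableAt ℝ (shifted S.Hp xbar) x :=
    (contDiff_shifted (S.contDiff_Hp (n := 1)) xbar).differentiable one_ne_zero x
  have hc' : DifferentiableAt ℝ (shifted S.Hc xbar) x :=
    (contDiff_shifted (S.contDiff_Hc (n := 1)) xbar).differentiable one_ne_zero x
  have ha : DifferentiableAt ℝ (S.Habar xbar) x :=
    (S.contDiffAt_Habar (n := 1) xbar (xEl_pos hx)).differentiableAt one_ne_zero
  have h1 := grad_add (hp'.add ha) hc'
  have h2 := grad_add hp' ha
  rw [← grad_shifted hp, ← grad_shifted hc, ← h2]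
  exact h1

theorem xC_grad_Hbar (hS : S.Standing) (xbar : State ng nl mc) {x : State ng nl mc}
    (hx : ∀ i, 0 < xE x i) : xC (grad (S.Hbar xbar) x) = S.zc x - S.zc xbar := by
  rw [← S.xC_grad_Hc hS, ← S.xC_grad_Hc hS, S.grad_Hbar xbar hx]
  ext i
  have h1 := congrFun (S.xC_grad_Hp x) i
  have h2 := congrFun (S.xC_grad_Hp xbar) i
  have h3 := S.grad_Habar_inl xbar (xEl_pos hx) (.inl i)
  simp only [xC, Pi.zero_apply] at h1 h2
  simp [xC, h1, h2, h3]

theorem xPhi_grad_Hbar (xbar : State ng nl mc) {x : State ng nl mc}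
    (hx : ∀ i, 0 < xE x i) :
    xPhi (grad (S.Hbar xbar) x) = xPhi (grad S.Hp x) - xPhi (grad S.Hp xbar) := by
  rw [S.grad_Hbar xbar hx]
  ext i
  simp [xPhi, S.grad_Habar_inl xbar (xEl_pos hx), S.grad_Hc_eq_zero]

theorem xP_grad_Hbar (xbar : State ng nl mc) {x : State ng nl mc}
    (hx : ∀ i, 0 < xE x i) :
    xP (grad (S.Hbar xbar) x) = S.omegaG x - S.omegaG xbar := by
  rw [← S.xP_grad_Hp, ← S.xP_grad_Hp, S.grad_Hbar xbar hx]
  ext i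
  simp [xP, S.grad_Habar_inl xbar (xEl_pos hx), S.grad_Hc_eq_zero]

theorem xEg_grad_Hbar (xbar : State ng nl mc) {x : State ng nl mc}
    (hx : ∀ i, 0 < xE x i) :
    xEg (grad (S.Hbar xbar) x) = xEg (grad S.Hp x) - xEg (grad S.Hp xbar) := by
  rw [S.grad_Hbar xbar hx]
  ext i
  simp [xEg, S.grad_Habar_inl xbar (xEl_pos hx), S.grad_Hc_eq_zero]

/-- The linear term of H̄_a restores the gradient that shifting H_p subtracts, and the logarithm
brings in Q̄_l. So [E_l] ∇_{E_l} H̄ = [E_l] ∇_{E_l} H_p - Q̄_l, the reactive power balance. -/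
theorem xEl_grad_Hbar (xbar : State ng nl mc) {x : State ng nl mc}
    (hx : ∀ i, 0 < xE x i) (i : Fin nl) :
    xEl (grad (S.Hbar xbar) x) i = xEl (grad S.Hp x) i - S.Q i / xEl x i := by
  rw [S.grad_Hbar xbar hx]
  have := S.xEl_grad_Habar xbar (xEl_pos hx) i
  simp only [xEl] at this
  simp [xEl, this, S.grad_Hc_eq_zero]

theorem contDiff_welfare (hS : S.Standing) : ContDiff ℝ 2 S.welfare := by
  have h1 : ContDiff ℝ 2 (cL : (CIdx ng nl mc → ℝ) → _) :=
    contDiff_pi.2 fun i => contDiff_apply ℝ ℝ _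
  have h2 : ContDiff ℝ 2 (cG : (CIdx ng nl mc → ℝ) → _) :=
    contDiff_pi.2 fun i => contDiff_apply ℝ ℝ _
  exact (hS.U_smooth.comp h1).sub (hS.C_smooth.comp h2)

theorem grad_welfare (hS : S.Standing) (z : CIdx ng nl mc → ℝ) :
    grad S.welfare z = colC (-grad S.C (cG z)) (grad S.U (cL z)) 0 0 0 := by
  let LG : (CIdx ng nl mc → ℝ) →L[ℝ] (Fin ng → ℝ) :=
    ContinuousLinearMap.pi fun i => ContinuousLinearMap.proj (.inl i)
  let LL : (CIdx ng nl mc → ℝ) →L[ℝ] (Fin nl → ℝ) :=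
    ContinuousLinearMap.pi fun i => ContinuousLinearMap.proj (.inr (.inl i))
  have hC := (hS.C_smooth.differentiable two_ne_zero (cG z)).hasFDerivAt
  have hU := (hS.U_smooth.differentiable two_ne_zero (cL z)).hasFDerivAt
  have h1 : HasFDerivAt S.welfare
      ((fderiv ℝ S.U (cL z)).comp LL - (fderiv ℝ S.C (cG z)).comp LG) z :=
    (HasFDerivAt.comp z (g := S.U) (f := cL) hU LL.hasFDerivAt).sub
      (HasFDerivAt.comp z (g := S.C) (f := cG) hC LG.hasFDerivAt)
  have hLG : ∀ w, LG w = cG w := fun w => rfl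
  have hLL : ∀ w, LL w = cL w := fun w => rfl
  have hG0 : ∀ j : CIdx ng nl mc, (∀ i, j ≠ .inl i) →
      cG (Pi.single j (1 : ℝ) : CIdx ng nl mc → ℝ) = 0 := by
    intro j hj; ext i; simp [cG, (hj i).symm]
  have hL0 : ∀ j : CIdx ng nl mc, (∀ i, j ≠ .inr (.inl i)) →
      cL (Pi.single j (1 : ℝ) : CIdx ng nl mc → ℝ) = 0 := by
    intro j hj; ext i; simp [cL, (hj i).symm]
  rw [h1.grad_eq]
  ext (i | i | i | i | i)
  · have : cG (Pi.single (.inl i) (1 : ℝ) : CIdx ng nl mc → ℝ) = Pi.single i 1 := by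
      ext j; simp [cG, Pi.single_apply]
    simp [hLG, hLL, hL0, this, colC, grad]
  · have : cL (Pi.single (.inr (.inl i)) (1 : ℝ) : CIdx ng nl mc → ℝ) = Pi.single i 1 := by
      ext j; simp [cL, Pi.single_apply]
    simp [hLG, hLL, hG0, this, colC, grad]
  all_goals simp [hLG, hLL, hG0, hL0, colC]

end Model

/-! ### Block decompositions -/

section Blocks

variable {ng nl mc : ℕ}

theorem colC_dotProduct (w : CIdx ng nl mc → ℝ) (a : Fin ng → ℝ) (b : Fin nl → ℝ) (c : Fin mc → ℝ)
    (d : Fin ng → ℝ) (e : Fin nl → ℝ) :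
    w ⬝ᵥ colC a b c d e = cG w ⬝ᵥ a + (cL w ⬝ᵥ b + (cV w ⬝ᵥ c + (cLamG w ⬝ᵥ d + cLamL w ⬝ᵥ e))) := by
  simp only [dotProduct, Fintype.sum_sum_type]
  rfl

theorem diffPart_dotProduct_colD (h : State ng nl mc) (c : CIdx ng nl mc → ℝ)
    (φ : Fin (ng + nl - 1) → ℝ) (p e : Fin ng → ℝ) :
    DAE.diffPart h ⬝ᵥ colD c φ p e =
      xC h ⬝ᵥ c + (xPhi h ⬝ᵥ φ + (xP h ⬝ᵥ p + xEg h ⬝ᵥ e)) := by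
  have : DAE.diffPart h = Sum.elim (xC h) (Sum.elim (xPhi h) (Sum.elim (xP h) (xEg h))) := by
    ext (i | i | i | i) <;> rfl
  rw [this, colD]
  simp only [sumElim_dotProduct_sumElim]

theorem state_eq_zero {h : State ng nl mc} (hG : cG (xC h) = 0) (hL : cL (xC h) = 0)
    (hV : cV (xC h) = 0) (hlg : cLamG (xC h) = 0) (hll : cLamL (xC h) = 0) (hφ : xPhi h = 0)
    (hp : xP h = 0) (hEg : xEg h = 0) (hEl : xEl h = 0) : h = 0 := by
  ext (((i | i | i | i | i) | i | i | i) | i)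
  · exact congrFun hG i
  · exact congrFun hL i
  · exact congrFun hV i
  · exact congrFun hlg i
  · exact congrFun hll i
  · exact congrFun hφ i
  · exact congrFun hp i
  · exact congrFun hEg i
  · exact congrFun hEl i

theorem eq_zero_of_toRows {ng nl : ℕ} {D : Matrix (Bus ng nl) (Fin (ng + nl - 1)) ℝ}
    (hD : LinearMap.ker (Dᵀ).mulVecLin ≤ Submodule.span ℝ {fun _ => (1 : ℝ)})
    {w : Fin (ng + nl - 1) → ℝ} (h1 : D.toRows₁ *ᵥ w = 0) (h2 : D.toRows₂ *ᵥ w = 0) : w = 0 := by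
  refine eq_zero_of_mulVec_eq_zero hD ?_
  ext (i | i)
  · exact congrFun h1 i
  · exact congrFun h2 i

end Blocks

namespace DAE

/-- A differential variable that is constant along a solution has vanishing velocity. -/
theorem IsSolutionOn.f_eq_zero {ι κ : Type} {S : DAE ι κ} {x : ℝ → ι ⊕ κ → ℝ}
    (hx : S.IsSolutionOn (Ici 0) x) {i : ι} {a : ℝ} (ha : ∀ t ≥ 0, x t (.inl i) = a) {t : ℝ}
    (ht : 0 ≤ t) : S.f (x t) i = 0 :=
  (uniqueDiffOn_Ici (0 : ℝ) t ht).eq_deriv _ (hx.differential t ht i)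
    ((hasDerivWithinAt_const t (Ici (0 : ℝ)) a).congr_of_mem ha ht)

end DAE

/-! ### Dissipation and regularity of the shifted system -/

namespace Model

section

variable {ng nl mc : ℕ} (S : Model ng nl mc)

/-- J_c is skew-symmetric. -/
theorem dotProduct_Jc (w : CIdx ng nl mc → ℝ) : w ⬝ᵥ S.Jc w = 0 := by
  simp only [Jc, colC_dotProduct, dotProduct_add, dotProduct_sub, dotProduct_neg,
    dotProduct_transpose_mulVec]
  rw [dotProduct_comm (cG w) (cLamG w), dotProduct_comm (cL w) (cLamL w)]
  ring

theorem posDef_Ag (hS : S.Standing) : S.Ag.PosDef := PosDef.diagonal fun _ => hS.A_pos _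

theorem posDef_inv_Al (hS : S.Standing) : (S.Al)⁻¹.PosDef :=
  (PosDef.diagonal fun _ => hS.A_pos _).inv

theorem posDef_Rg (hS : S.Standing) : S.Rg.PosDef :=
  PosDef.diagonal fun i => div_pos (sub_pos.2 (hS.Xd_gt i)) (hS.T_pos i)

/-- The couplings through J_c, G_1 and D̂_g cancel in pairs. The four terms with A_l⁻¹ combine into
one quadratic form in G_2ᵀ∇H̄ + D̂_l ∇_φ H̄. -/
theorem diffPart_dotProduct_f (xbar x : State ng nl mc) :
    DAE.diffPart (grad (S.Hbar xbar) x) ⬝ᵥ (S.shiftedSystem xbar).f x =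
      xC (grad (S.Hbar xbar) x) ⬝ᵥ (grad S.welfare (S.zc x) - grad S.welfare (S.zc xbar))
      - (cL (xC (grad (S.Hbar xbar) x)) + S.Dhat.toRows₂ *ᵥ xPhi (grad (S.Hbar xbar) x)) ⬝ᵥ
        ((S.Al)⁻¹ *ᵥ
          (cL (xC (grad (S.Hbar xbar) x)) + S.Dhat.toRows₂ *ᵥ xPhi (grad (S.Hbar xbar) x)))
      - xP (grad (S.Hbar xbar) x) ⬝ᵥ (S.Ag *ᵥ xP (grad (S.Hbar xbar) x))
      - xEg (grad (S.Hbar xbar) x) ⬝ᵥ (S.Rg *ᵥ xEg (grad (S.Hbar xbar) x)) := by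
  simp only [shiftedSystem]
  generalize grad (S.Hbar xbar) x = h
  rw [diffPart_dotProduct_colD, dotProduct_add (xC h), dotProduct_add (xC h), dotProduct_Jc,
    colC_dotProduct]
  simp only [dotProduct_add, dotProduct_sub, dotProduct_neg, dotProduct_zero, add_dotProduct,
    mulVec_add, dotProduct_transpose_mulVec]
  rw [dotProduct_comm (cG (xC h)) (xP h),
    dotProduct_comm ((S.Al)⁻¹ *ᵥ cL (xC h)) (S.Dhat.toRows₂ *ᵥ xPhi h),
    dotProduct_comm ((S.Al)⁻¹ *ᵥ S.Dhat.toRows₂ *ᵥ xPhi h) (S.Dhat.toRows₂ *ᵥ xPhi h)]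
  ring

theorem dotProduct_grad_welfare (hS : S.Standing) (z z' : CIdx ng nl mc → ℝ) :
    (z - z') ⬝ᵥ (grad S.welfare z - grad S.welfare z') =
      -((grad S.C (cG z) - grad S.C (cG z')) ⬝ᵥ (cG z - cG z'))
      + (grad S.U (cL z) - grad S.U (cL z')) ⬝ᵥ (cL z - cL z') := by
  have h : grad S.welfare z - grad S.welfare z' =
      colC (-(grad S.C (cG z) - grad S.C (cG z'))) (grad S.U (cL z) - grad S.U (cL z')) 0 0 0 := by
    rw [S.grad_welfare hS, S.grad_welfare hS]
    ext (i | i | i | i | i) <;> simp [colC, sub_eq_add_neg, add_comm]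
  rw [h, colC_dotProduct, dotProduct_neg, dotProduct_comm (cG (z - z')),
    dotProduct_comm (cL (z - z'))]
  simp only [dotProduct_zero, add_zero]
  rfl

theorem grad_C_mono (hS : S.Standing) {P P' : Fin ng → ℝ} :
    0 ≤ (grad S.C P - grad S.C P') ⬝ᵥ (P - P') ∧
      ((grad S.C P - grad S.C P') ⬝ᵥ (P - P') = 0 → P = P') := by
  rcases eq_or_ne P P' with rfl | hne
  · simp
  have := hS.C_convex.grad_sub_dotProduct_pos (hS.C_smooth.differentiable two_ne_zero) hne
  exact ⟨this.le, fun h => absurd h this.ne'⟩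

theorem grad_U_anti (hS : S.Standing) {P P' : Fin nl → ℝ} :
    (grad S.U P - grad S.U P') ⬝ᵥ (P - P') ≤ 0 ∧
      ((grad S.U P - grad S.U P') ⬝ᵥ (P - P') = 0 → P = P') := by
  rcases eq_or_ne P P' with rfl | hne
  · simp
  have hd : Differentiable ℝ S.U := hS.U_smooth.differentiable two_ne_zero
  have h := hS.U_concave.neg.grad_sub_dotProduct_pos hd.neg hne
  have hg : ∀ Q, grad (-S.U) Q = -grad S.U Q := fun Q => (hd Q).hasFDerivAt.neg.grad_eq
  rw [hg, hg, neg_sub_neg, ← neg_sub, neg_dotProduct] at h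
  have h' := neg_pos.1 h
  exact ⟨h'.le, fun h0 => absurd h0 h'.ne⟩

theorem posDef_dotProduct {n : Type} [Fintype n] {A : Matrix n n ℝ} (hA : A.PosDef) (v : n → ℝ) :
    0 ≤ v ⬝ᵥ (A *ᵥ v) ∧ (v ⬝ᵥ (A *ᵥ v) = 0 → v = 0) := by
  rcases eq_or_ne v 0 with rfl | hv
  · simp
  have : 0 < v ⬝ᵥ (A *ᵥ v) := by simpa using hA.dotProduct_mulVec_pos hv
  exact ⟨this.le, fun h => absurd h this.ne'⟩

/-- The dissipation inequality for `H̄`, and the case of equality. -/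
theorem dissipation (hS : S.Standing) (xbar : State ng nl mc) {x : State ng nl mc}
    (hx : ∀ i, 0 < xE x i) :
    DAE.diffPart (grad (S.Hbar xbar) x) ⬝ᵥ (S.shiftedSystem xbar).f x ≤ 0 ∧
    (DAE.diffPart (grad (S.Hbar xbar) x) ⬝ᵥ (S.shiftedSystem xbar).f x = 0 →
      cG (S.zc x) = cG (S.zc xbar) ∧ cL (S.zc x) = cL (S.zc xbar) ∧
      cL (xC (grad (S.Hbar xbar) x)) + S.Dhat.toRows₂ *ᵥ xPhi (grad (S.Hbar xbar) x) = 0 ∧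
      xP (grad (S.Hbar xbar) x) = 0 ∧ xEg (grad (S.Hbar xbar) x) = 0) := by
  have hW : xC (grad (S.Hbar xbar) x) ⬝ᵥ (grad S.welfare (S.zc x) - grad S.welfare (S.zc xbar)) =
      -((grad S.C (cG (S.zc x)) - grad S.C (cG (S.zc xbar))) ⬝ᵥ (cG (S.zc x) - cG (S.zc xbar)))
      + (grad S.U (cL (S.zc x)) - grad S.U (cL (S.zc xbar))) ⬝ᵥ
        (cL (S.zc x) - cL (S.zc xbar)) := by
    rw [S.xC_grad_Hbar hS xbar hx, S.dotProduct_grad_welfare hS]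
  have h1 := S.grad_C_mono hS (P := cG (S.zc x)) (P' := cG (S.zc xbar))
  have h2 := S.grad_U_anti hS (P := cL (S.zc x)) (P' := cL (S.zc xbar))
  have h3 := posDef_dotProduct (S.posDef_inv_Al hS)
    (cL (xC (grad (S.Hbar xbar) x)) + S.Dhat.toRows₂ *ᵥ xPhi (grad (S.Hbar xbar) x))
  have h4 := posDef_dotProduct (S.posDef_Ag hS) (xP (grad (S.Hbar xbar) x))
  have h5 := posDef_dotProduct (S.posDef_Rg hS) (xEg (grad (S.Hbar xbar) x))
  rw [diffPart_dotProduct_f, hW]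
  -- Five nonpositive contributions add up to the rate; if the rate is zero, each of them is.
  refine ⟨by linarith [h1.1, h2.1, h3.1, h4.1, h5.1], fun h0 => ?_⟩
  exact ⟨h1.2 (by linarith [h1.1, h2.1, h3.1, h4.1, h5.1]),
    h2.2 (by linarith [h1.1, h2.1, h3.1, h4.1, h5.1]),
    h3.2 (by linarith [h1.1, h2.1, h3.1, h4.1, h5.1]),
    h4.2 (by linarith [h1.1, h2.1, h3.1, h4.1, h5.1]),
    h5.2 (by linarith [h1.1, h2.1, h3.1, h4.1, h5.1])⟩

theorem isOpen_dom (xbar : State ng nl mc) : IsOpen (S.shiftedSystem xbar).dom := by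
  have : (S.shiftedSystem xbar).dom = ⋂ i, {x : State ng nl mc | 0 < xE x i} := by
    ext x; simp [shiftedSystem]
  rw [this]
  refine isOpen_iInter_of_finite fun i => ?_
  rcases i with i | i <;> exact isOpen_lt continuous_const (continuous_apply _)

/-- Positive voltages make [E_l] invertible. -/
theorem algebraic_iff (xbar : State ng nl mc) {x : State ng nl mc} (hx : ∀ i, 0 < xE x i) :
    (S.shiftedSystem xbar).g x = 0 ↔ ∀ k, grad (S.Hbar xbar) x (.inr k) = 0 := by
  simp only [shiftedSystem, neg_eq_zero, funext_iff, mulVec_diagonal, Pi.zero_apply, mul_eq_zero,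
    (xEl_pos hx _).ne', false_or]
  rfl

/-- The vector field is an affine function of the pair (∇H̄(x), ∇S(z_c)), and each entry of the pair
is C¹ as the gradient of a C² function. -/
theorem contDiffAt_f (hS : S.Standing) {xbar : State ng nl mc} (hx : ∀ i, 0 < xE xbar i) :
    ContDiffAt ℝ 1 (S.shiftedSystem xbar).f xbar := by
  have hh : ContDiffAt ℝ 1 (grad (S.Hbar xbar)) xbar := (S.contDiffAt_Hbar xbar hx).grad_of_two
  have hz : ContDiff ℝ 1 (S.zc : State ng nl mc → _) := by
    unfold zc mulVec dotProduct xC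
    fun_prop
  have hw : ContDiff ℝ 1 fun x => grad S.welfare (S.zc x) :=
    (contDiff_iff_contDiffAt.2 fun z => (S.contDiff_welfare hS).contDiffAt.grad_of_two).comp hz
  have hpair := hh.prodMk hw.contDiffAt
  have hΦ : ContDiff ℝ 1 fun p : State ng nl mc × (CIdx ng nl mc → ℝ) =>
      colD
        (S.Jc (xC p.1)
          + colC (-xP p.1)
              (-((S.Al)⁻¹ *ᵥ cL (xC p.1)) - (S.Al)⁻¹ *ᵥ (S.Dhat.toRows₂ *ᵥ xPhi p.1)) 0 0 0
          + (p.2 - grad S.welfare (S.zc xbar)))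
        (-(S.Dhat.toRows₂ᵀ *ᵥ ((S.Al)⁻¹ *ᵥ cL (xC p.1)))
          - S.Dhat.toRows₂ᵀ *ᵥ ((S.Al)⁻¹ *ᵥ (S.Dhat.toRows₂ *ᵥ xPhi p.1))
          + S.Dhat.toRows₁ᵀ *ᵥ xP p.1)
        (cG (xC p.1) - S.Dhat.toRows₁ *ᵥ xPhi p.1 - S.Ag *ᵥ xP p.1)
        (-(S.Rg *ᵥ xEg p.1)) := by
    refine contDiff_pi.2 fun j => ?_
    rcases j with (i | i | i | i | i) | i | i | i <;>
    · simp only [colD, colC, Jc, Sum.elim_inl, Sum.elim_inr, Pi.add_apply, Pi.sub_apply,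
        Pi.neg_apply, Pi.zero_apply, mulVec, dotProduct, cG, cL, cV, cLamG, cLamL, xC, xPhi, xP,
        xEg]
      fun_prop
  exact hΦ.contDiffAt.comp xbar hpair

theorem statePart_join (x : State ng nl mc) (ωl : Fin nl → ℝ) : statePart (join x ωl) = x := by
  ext (i | i) <;> rfl

theorem freqPart_join (x : State ng nl mc) (ωl : Fin nl → ℝ) : freqPart (join x ωl) = ωl := rfl

/-- All blocks but E_l vanish by the shift. The E_l block vanishes by the reactive power balance of
the closed loop at the equilibrium. -/
theorem grad_Hbar_self (hS : S.Standing) {xbar : State ng nl mc} {ωl : Fin nl → ℝ}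
    (heq : S.closedLoop.IsEquilibrium (join xbar ωl)) : grad (S.Hbar xbar) xbar = 0 := by
  obtain ⟨hdom, -, hg⟩ := heq
  have hx : ∀ i, 0 < xE xbar i := by simpa [closedLoop, statePart_join] using hdom
  have hC := S.xC_grad_Hbar hS xbar hx
  rw [sub_self] at hC
  refine state_eq_zero (by rw [hC]; rfl) (by rw [hC]; rfl) (by rw [hC]; rfl) (by rw [hC]; rfl)
    (by rw [hC]; rfl) (by rw [S.xPhi_grad_Hbar xbar hx, sub_self])
    (by rw [S.xP_grad_Hbar xbar hx, sub_self]) (by rw [S.xEg_grad_Hbar xbar hx, sub_self]) ?_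
  ext i
  have h1 := congrFun hg (.inl i)
  simp only [closedLoop, statePart_join, Sum.elim_inl, Pi.add_apply, Pi.neg_apply,
    mulVec_diagonal, Pi.zero_apply] at h1
  rw [grad_add (S.contDiff_Hp.differentiable one_ne_zero _)
    (S.contDiff_Hc.differentiable one_ne_zero _)] at h1
  have h2 : xEl (grad S.Hp xbar + grad S.Hc xbar) i = xEl (grad S.Hp xbar) i := by
    simp [xEl, S.grad_Hc_eq_zero]
  rw [h2] at h1
  have hE := xEl_pos hx i
  rw [S.xEl_grad_Hbar xbar hx, Pi.zero_apply, sub_eq_zero, eq_div_iff hE.ne']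
  linarith

end

/-! ### Conserved solutions and equilibria -/

variable {ng nl : ℕ} (S : Model ng nl (ng + nl - 1))

/-- A state from which `H̄` is conserved is a critical point of `H̄`. -/
theorem grad_Hbar_eq_zero_of_conserved (hS : S.Standing) (hDc : IsTreeIncidence S.Dc)
    (xbar : State ng nl (ng + nl - 1)) {x : ℝ → State ng nl (ng + nl - 1)}
    (hx : (S.shiftedSystem xbar).IsSolutionOn (Ici 0) x)
    (h0 : ∀ t ≥ 0, DAE.diffPart (grad (S.Hbar xbar) (x t)) ⬝ᵥ (S.shiftedSystem xbar).f (x t) = 0) :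
    grad (S.Hbar xbar) (x 0) = 0 := by
  have hpos : ∀ t ≥ 0, ∀ i, 0 < xE (x t) i := fun t ht => hx.mem_dom t ht
  have key := fun t (ht : t ≥ 0) => (S.dissipation hS xbar (hpos t ht)).2 (h0 t ht)
  have hC := fun t (ht : t ≥ 0) => S.xC_grad_Hbar hS xbar (hpos t ht)
  have hxc : ∀ t, xC (x t) = S.τc *ᵥ S.zc (x t) := fun t => (S.τc_mulVec_zc hS _).symm
  have hG : ∀ t ≥ 0, cG (xC (grad (S.Hbar xbar) (x t))) = 0 := fun t ht => by
    rw [hC t ht]; exact sub_eq_zero.2 (key t ht).1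
  have hL : ∀ t ≥ 0, cL (xC (grad (S.Hbar xbar) (x t))) = 0 := fun t ht => by
    rw [hC t ht]; exact sub_eq_zero.2 (key t ht).2.1
  have hP := fun t (ht : t ≥ 0) => (key t ht).2.2.2.1
  have hw : ∀ t ≥ 0, grad S.welfare (S.zc (x t)) - grad S.welfare (S.zc xbar) = 0 := by
    intro t ht
    rw [S.grad_welfare hS, S.grad_welfare hS, (key t ht).1, (key t ht).2.1, sub_self]
  have hDl : ∀ t ≥ 0, S.Dhat.toRows₂ *ᵥ xPhi (grad (S.Hbar xbar) (x t)) = 0 := by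
    intro t ht
    have := (key t ht).2.2.1
    rwa [hL t ht, zero_add] at this
  have hlg : ∀ t ≥ 0, cLamG (xC (grad (S.Hbar xbar) (x t))) = 0 := by
    intro t ht
    ext i
    -- The block τ_g P_g is constant, so its velocity is zero; with ω_g and ∇C at their equilibrium
    -- values, that velocity is λ_g - λ̄_g. This is shown for all t, since constancy of λ_g is used
    -- next.
    have hconst : ∀ u ≥ 0, x u (.inl (.inl (.inl i))) = (S.τg *ᵥ cG (S.zc xbar)) i := by
      intro u hu
      change xC (x u) (.inl i) = _
      rw [hxc, S.τc_mulVec, (key u hu).1]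
      rfl
    have := hx.f_eq_zero hconst ht
    simpa [shiftedSystem, colD, colC, Jc, hP t ht, hw t ht] using this
  have hll : ∀ t ≥ 0, cLamL (xC (grad (S.Hbar xbar) (x t))) = 0 := by
    intro t ht
    ext i
    have hconst : ∀ u ≥ 0, x u (.inl (.inl (.inr (.inl i)))) = (S.τl *ᵥ cL (S.zc xbar)) i := by
      intro u hu
      change xC (x u) (.inr (.inl i)) = _
      rw [hxc, S.τc_mulVec, (key u hu).2.1]
      rfl
    have := hx.f_eq_zero hconst ht
    simpa [-mulVec_mulVec, shiftedSystem, colD, colC, Jc, hL t ht, hDl t ht, hw t ht] using this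
  -- The multipliers are constant in turn; their zero velocities read D_c(v - v̄) = 0, and D_c is
  -- injective.
  have hV : cV (xC (grad (S.Hbar xbar) (x 0))) = 0 := by
    refine eq_zero_of_toRows hDc.ker_transpose_le ?_ ?_
    · ext i
      have hconst : ∀ u ≥ 0, x u (.inl (.inl (.inr (.inr (.inr (.inl i)))))) =
          (S.τlamg *ᵥ cLamG (S.zc xbar)) i := by
        intro u hu
        have h1 := hlg u hu
        rw [hC u hu] at h1
        change xC (x u) (.inr (.inr (.inr (.inl i)))) = _
        rw [hxc, S.τc_mulVec, ← sub_eq_zero.1 (show cLamG (S.zc (x u)) - cLamG (S.zc xbar) = 0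
          from h1)]
        rfl
      have := hx.f_eq_zero hconst le_rfl
      simpa [shiftedSystem, colD, colC, Jc, hG 0 le_rfl, hw 0 le_rfl] using this
    · ext i
      have hconst : ∀ u ≥ 0, x u (.inl (.inl (.inr (.inr (.inr (.inr i)))))) =
          (S.τlaml *ᵥ cLamL (S.zc xbar)) i := by
        intro u hu
        have h1 := hll u hu
        rw [hC u hu] at h1
        change xC (x u) (.inr (.inr (.inr (.inr i)))) = _
        rw [hxc, S.τc_mulVec, ← sub_eq_zero.1 (show cLamL (S.zc (x u)) - cLamL (S.zc xbar) = 0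
          from h1)]
        rfl
      have := hx.f_eq_zero hconst le_rfl
      simpa [shiftedSystem, colD, colC, Jc, hL 0 le_rfl, hw 0 le_rfl] using this
  -- Constant p_g gives D̂_g ∇_φ H̄ = 0. Together with the load rows from zero dissipation this is
  -- D̂ ∇_φ H̄ = 0.
  have hφ : xPhi (grad (S.Hbar xbar) (x 0)) = 0 := by
    refine eq_zero_of_toRows hS.Dhat_ker.le ?_ (hDl 0 le_rfl)
    ext i
    have hconst : ∀ u ≥ 0, x u (.inl (.inr (.inr (.inl i)))) = xP xbar i := by
      intro u hu
      have h1 := congrFun (hP u hu) i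
      rw [S.xP_grad_Hbar xbar (hpos u hu)] at h1
      have h2 : (S.M i)⁻¹ * xP (x u) i = (S.M i)⁻¹ * xP xbar i := sub_eq_zero.1 h1
      exact mul_left_cancel₀ (inv_ne_zero (hS.M_pos i).ne') h2
    have := hx.f_eq_zero hconst le_rfl
    simpa [shiftedSystem, colD, hG 0 le_rfl, hP 0 le_rfl] using this
  refine state_eq_zero (hG 0 le_rfl) (hL 0 le_rfl) hV (hlg 0 le_rfl) (hll 0 le_rfl) hφ (hP 0 le_rfl)
    (key 0 le_rfl).2.2.2.2 ?_
  ext k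
  exact (S.algebraic_iff xbar (hpos 0 le_rfl)).1 (hx.algebraic 0 (mem_Ici.2 le_rfl)) k

/-- ∇H̄ vanishes at `xbar`, and so does the difference of welfare gradients, which are the only
terms on the right-hand side. -/
theorem isEquilibrium_shiftedSystem (hS : S.Standing) {xbar : State ng nl (ng + nl - 1)}
    {ωl : Fin nl → ℝ} (heq : S.closedLoop.IsEquilibrium (join xbar ωl)) :
    (S.shiftedSystem xbar).IsEquilibrium xbar := by
  have h0 := S.grad_Hbar_self hS heq
  have hx : ∀ i, 0 < xE xbar i := by simpa [closedLoop, statePart_join] using heq.1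
  refine ⟨hx, ?_, (S.algebraic_iff xbar hx).2 fun k => by rw [h0]; rfl⟩
  have hC : xC (0 : State ng nl (ng + nl - 1)) = 0 := rfl
  have hφ : xPhi (0 : State ng nl (ng + nl - 1)) = 0 := rfl
  have hP : xP (0 : State ng nl (ng + nl - 1)) = 0 := rfl
  have hE : xEg (0 : State ng nl (ng + nl - 1)) = 0 := rfl
  have hcG : cG (0 : CIdx ng nl (ng + nl - 1) → ℝ) = 0 := rfl
  have hcL : cL (0 : CIdx ng nl (ng + nl - 1) → ℝ) = 0 := rfl
  have hcV : cV (0 : CIdx ng nl (ng + nl - 1) → ℝ) = 0 := rfl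
  have hcg : cLamG (0 : CIdx ng nl (ng + nl - 1) → ℝ) = 0 := rfl
  have hcl : cLamL (0 : CIdx ng nl (ng + nl - 1) → ℝ) = 0 := rfl
  ext ((i | i | i | i | i) | i | i | i) <;>
    simp [shiftedSystem, h0, colD, colC, Jc, hC, hφ, hP, hE, hcG, hcL, hcV, hcg, hcl]

/-- At an equilibrium the frequency deviations vanish and the KKT conditions hold. -/
theorem omega_eq_zero_and_kkt (hS : S.Standing) (hDc : IsTreeIncidence S.Dc)
    {xbar : State ng nl (ng + nl - 1)} {ωl : Fin nl → ℝ}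
    (heq : S.closedLoop.IsEquilibrium (join xbar ωl)) :
    S.omegaG xbar = 0 ∧ ωl = 0 ∧
      S.KKT (cG (S.zc xbar)) (cL (S.zc xbar)) (cV (S.zc xbar)) (cLamG (S.zc xbar))
        (cLamL (S.zc xbar)) := by
  obtain ⟨-, hf, hg⟩ := heq
  have hh : grad (fun x => S.Hp x + S.Hc x) xbar = grad S.Hp xbar + grad S.Hc xbar :=
    grad_add (S.contDiff_Hp.differentiable one_ne_zero _)
      (S.contDiff_Hc.differentiable one_ne_zero _)
  have hC : xC (grad S.Hp xbar + grad S.Hc xbar) = S.zc xbar := by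
    have : xC (grad S.Hp xbar + grad S.Hc xbar) = xC (grad S.Hp xbar) + xC (grad S.Hc xbar) := rfl
    rw [this, S.xC_grad_Hp, S.xC_grad_Hc hS, zero_add]
  have hP : xP (grad S.Hp xbar + grad S.Hc xbar) = S.omegaG xbar := by
    rw [← S.xP_grad_Hp]
    ext i
    simp [xP, S.grad_Hc_eq_zero]
  simp only [closedLoop, statePart_join, freqPart_join, hh, hC, hP, S.grad_welfare hS] at hf hg
  -- The value of ∇_φ H_p is irrelevant: the flows D̂η sum to zero over the buses for every η.
  generalize xPhi (grad S.Hp xbar + grad S.Hc xbar) = η at hf hg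
  have fG : ∀ i, cLamG (S.zc xbar) i - S.omegaG xbar i - grad S.C (cG (S.zc xbar)) i = 0 := by
    intro i
    have := congrFun hf (.inl (.inl i))
    simp only [colD, colC, Jc, Sum.elim_inl, Pi.add_apply, Pi.neg_apply, Pi.zero_apply] at this
    linarith
  have fL : ∀ i, -cLamL (S.zc xbar) i + ωl i + grad S.U (cL (S.zc xbar)) i = 0 := fun i => by
    have := congrFun hf (.inl (.inr (.inl i)))
    simpa [colD, colC, Jc] using this
  have fV : S.Dc.toRows₁ᵀ *ᵥ cLamG (S.zc xbar) + S.Dc.toRows₂ᵀ *ᵥ cLamL (S.zc xbar) = 0 := by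
    ext i
    have := congrFun hf (.inl (.inr (.inr (.inl i))))
    simp only [colD, colC, Jc, Sum.elim_inl, Sum.elim_inr, Pi.add_apply, Pi.neg_apply,
      Pi.sub_apply, Pi.zero_apply] at this ⊢
    linarith
  have fg : ∀ i, -cG (S.zc xbar) i + (S.Dc.toRows₁ *ᵥ cV (S.zc xbar)) i = 0 := fun i => by
    have := congrFun hf (.inl (.inr (.inr (.inr (.inl i)))))
    simpa [colD, colC, Jc] using this
  have fl : ∀ i, cL (S.zc xbar) i + (S.Dc.toRows₂ *ᵥ cV (S.zc xbar)) i = 0 := fun i => by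
    have := congrFun hf (.inl (.inr (.inr (.inr (.inr i)))))
    simpa [colD, colC, Jc] using this
  have fφ : S.Dhatᵀ *ᵥ (Sum.elim (S.omegaG xbar) ωl) = 0 := by
    ext k
    have := congrFun hf (.inr (.inl k))
    simp only [colD, Sum.elim_inl, Sum.elim_inr, Pi.add_apply, Pi.zero_apply] at this
    rw [Pi.zero_apply, ← this]
    simp [mulVec, dotProduct, Fintype.sum_sum_type]
  have fp : ∀ i, cG (S.zc xbar) i - (S.Dhat *ᵥ η) (.inl i) - S.A (.inl i) * S.omegaG xbar i = 0 := by
    intro i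
    have := congrFun hf (.inr (.inr (.inl i)))
    simp only [colD, Sum.elim_inl, Sum.elim_inr, Pi.sub_apply, Pi.zero_apply, Ag,
      mulVec_diagonal] at this
    exact this
  have gl : ∀ i, -cL (S.zc xbar) i - (S.Dhat *ᵥ η) (.inr i) - S.A (.inr i) * ωl i = 0 := by
    intro i
    have := congrFun hg (.inr i)
    simp only [Sum.elim_inr, Pi.sub_apply, Pi.neg_apply, Pi.zero_apply, Al,
      mulVec_diagonal] at this
    exact this
  -- D̂ᵀω = 0 means that all buses share one frequency deviation a.
  obtain ⟨a, ha⟩ : ∃ a : ℝ, a • (fun _ : Bus ng nl => (1 : ℝ)) = Sum.elim (S.omegaG xbar) ωl := by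
    rw [← Submodule.mem_span_singleton, ← hS.Dhat_ker]
    exact fφ
  have hone : ∑ i, (S.Dhat *ᵥ η) i = 0 := by
    have h1 : (fun _ => (1 : ℝ)) ∈ LinearMap.ker (S.Dhatᵀ).mulVecLin := by
      rw [hS.Dhat_ker]
      exact Submodule.mem_span_singleton_self _
    have h2 : S.Dhatᵀ *ᵥ (fun _ => (1 : ℝ)) = 0 := h1
    have h3 : (fun _ => (1 : ℝ)) ⬝ᵥ (S.Dhat *ᵥ η) = 0 := by
      rw [← dotProduct_transpose_mulVec, h2, dotProduct_zero]
    simpa [dotProduct] using h3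
  have hall : ∀ i, (S.Dc *ᵥ cV (S.zc xbar)) i - (S.Dhat *ᵥ η) i - S.A i * a = 0 := by
    rintro (i | i)
    · have h1 : a * 1 = S.omegaG xbar i := congrFun ha (.inl i)
      have h2 : -cG (S.zc xbar) i + (S.Dc *ᵥ cV (S.zc xbar)) (.inl i) = 0 := fg i
      have h3 := fp i
      rw [← h1, mul_one] at h3
      linarith
    · have h1 : a * 1 = ωl i := congrFun ha (.inr i)
      have h2 : cL (S.zc xbar) i + (S.Dc *ᵥ cV (S.zc xbar)) (.inr i) = 0 := fl i
      have h3 := gl i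
      rw [← h1, mul_one] at h3
      linarith
  -- Summing the bus balances cancels D_c v and D̂η, since the columns of both matrices sum to zero;
  -- positive total damping then forces a = 0.
  have ha0 : a = 0 := by
    have h1 := Finset.sum_eq_zero fun i (_ : i ∈ Finset.univ) => hall i
    rw [Finset.sum_sub_distrib, Finset.sum_sub_distrib, hDc.sum_mulVec, hone,
      ← Finset.sum_mul] at h1
    have hne := hS.connected.nonempty
    have hpos : 0 < ∑ i, S.A i :=
      Finset.sum_pos (fun i _ => hS.A_pos i) Finset.univ_nonempty
    have h2 : (∑ i, S.A i) * a = 0 := by linarith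
    exact (mul_eq_zero.1 h2).resolve_left hpos.ne'
  rw [ha0, zero_smul] at ha
  have hω : S.omegaG xbar = 0 := by
    ext i
    exact (congrFun ha (.inl i)).symm
  have hωl : ωl = 0 := by
    ext i
    exact (congrFun ha (.inr i)).symm
  refine ⟨hω, hωl, ⟨?_, ?_, fV, ?_, ?_⟩⟩
  · ext i
    have := fG i
    rw [hω, Pi.zero_apply] at this
    simp only [Pi.sub_apply, Pi.zero_apply]
    linarith
  · ext i
    have := fL i
    rw [hωl, Pi.zero_apply] at this
    simp only [Pi.add_apply, Pi.neg_apply, Pi.zero_apply]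
    linarith
  · ext i
    have := fg i
    simp only [Pi.add_apply, Pi.neg_apply, Pi.zero_apply]
    linarith
  · ext i
    have := fl i
    simp only [Pi.sub_apply, Pi.neg_apply, Pi.zero_apply]
    linarith

end Model

end

/-! ### The main theorem -/

theorem theorem2 {ng nl : ℕ} (S : Model ng nl (ng + nl - 1)) (hS : S.Standing)
    (hDc : IsTreeIncidence S.Dc)
    (xbar : State ng nl (ng + nl - 1)) (ωl : Fin nl → ℝ)
    (heq : S.closedLoop.IsEquilibrium (Model.join xbar ωl))
    (hH : (hess (S.Hbar xbar) xbar).PosDef) :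
    (S.shiftedSystem xbar).LocallyAsymptoticallyStable xbar ∧
    S.omegaG xbar = 0 ∧ ωl = 0 ∧
    S.KKT (cG (S.zc xbar)) (cL (S.zc xbar)) (cV (S.zc xbar)) (cLamG (S.zc xbar))
      (cLamL (S.zc xbar)) := by
  have hE := S.isEquilibrium_shiftedSystem hS heq
  refine ⟨?_, S.omega_eq_zero_and_kkt hS hDc heq⟩
  exact DAE.locallyAsymptoticallyStable_of_lyapunov (S.isOpen_dom xbar) hE
    (fun x hx => S.contDiffAt_Hbar xbar hx) (S.contDiffAt_f hS hE.1) hH (S.grad_Hbar_self hS heq)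
    (fun x hx => S.algebraic_iff xbar hx) (fun x hx _ => (S.dissipation hS xbar hx).1)
    (fun x hx h0 => S.grad_Hbar_eq_zero_of_conserved hS hDc xbar hx h0)
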